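/- Elementary gates on $n$ wires are NOT, $S$, $T$, $H$, CNOT, controlled-$R_x(\theta)$ with $\theta\in\{\pi,\pm\frac{\pi}{2},\pm\frac{\pi}{4},\dots,\pm\frac{\pi}{2^{n-3}}\}$, and controlled-$V_i$, controlled-$V_i^\dagger$ with $1\le i\le n-2$, where $V_i$ is the principal $2^i$-th root of NOT. A circuit on $n$ wires is a finite sequence of elementary gates, without ancillary wires; it implements a $2^n\times2^n$ matrix if the product of its gates equals that matrix. For a permutation matrix $P$ on the basis states $|x\rangle$, $x\in\{0,1\}^n$, write $P|x\rangle=|P(x)\rangle$ and $S_P=\{x: P(x)\ne x\}$. **Theorem.** There is an absolute constant $K>0$ such that for every $n\ge 2$ and every $2^n\times 2^n$ permutation matrix $P$ there is a permutation matrix $P_Q$, implemented by a circuit of at most $K\,2^n n/\log n$ elementary gates, with $$|S_{P_QP}|\le 2^{n/2-1}.$$ Moreover, for $n\ge 8$ and $m=\lfloor\log_2 n\rfloor-1$, one can take $P_Q=Q_d\cdots Q_2Q_1$ with $d\le 8\cdot 2^n/n$, the circuit being the concatenation of circuits of at most $K n^2/\log n$ elementary gates each for $Q_1,\dots,Q_d$,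 such that for every $s$, with $f=Q_{s-1}\cdots Q_1P$ and $Q=Q_s$: 1. There are $2^{m-1}$ pairs $(a_t,b_t)$ with $b_t=f(a_t)\neq a_t$, and vectors $z_t\in\mathbb F_2^n$ with $z_1=b_1$, such that $a_1,z_1,a_2,z_2,\dots,a_{2^{m-1}},z_{2^{m-1}}$ are linearly independent over $\mathbb F_2$ and, for each $t$, neither $a_t$ nor $b_t$ lies in the span of $a_1,z_1,\dots,a_{t-1},z_{t-1}$. The map $Q$ exchanges $a_t$ and $b_t$ for every $t$ and fixes all other basis states. 2. $Q=(P_{map}P_e)^{-1}\,T\,(P_{map}P_e)$, where $T$ flips the last bit if and only if the first $n-m$ bits are $10\cdots0$, and where $P_{map}P_e$ is implemented by a circuit of at most $K n^2/\log n$ elementary gates. 3. $P_e$ maps $a_t$ to $e_{2t-1}$ and $b_t$ to $e_{2t}$ for every $t$, where $e_j$ is the bit string whose only $1$ is in position $j$, and $P_e$ is the composition of a linear reversible map, at most $2^{m-1}-1$ Toffoli gates, and a linear reversible map. 4. $P_{map}$ maps $e_j$ to $10\cdots0$ ($n-m$ bits) followed by the $m$-bit binary expansion of $j-1$, for $1\le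 j\le 2^m$, and is a product of at most $K n\log n$ CNOT and Toffoli gates. -/

import Mathlib

namespace RevSynth

/-- The basis states of `n` wires: bit strings `x = (x 0, …, x (n-1))` over the two-element field;
`x 0` is the first (most significant) bit. -/
abbrev Bits (n : ℕ) : Type := Fin n → ZMod 2

/-- The `2^n × 2^n` permutation matrix of a reversible function `σ`: it maps the basis vector
indexed by `x` to the basis vector indexed by `σ x`. -/
def permMatrix {n : ℕ} (σ : Equiv.Perm (Bits n)) : Matrix (Bits n) (Bits n) ℂ :=
  Matrix.of fun y x => if y = σ x then 1 else 0

/-! ### One-qubit matrices -/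

noncomputable section

/-- The `2 × 2` matrix with rows `(a, b)` and `(c, d)`, indexed by the two values of a bit. -/
def mat2 (a b c d : ℂ) : Matrix (ZMod 2) (ZMod 2) ℂ :=
  Matrix.of fun y x => if y = 0 then (if x = 0 then a else b) else (if x = 0 then c else d)

/-- NOT. -/
def gateX : Matrix (ZMod 2) (ZMod 2) ℂ := mat2 0 1 1 0

/-- The phase gate `S`. -/
def gateS : Matrix (ZMod 2) (ZMod 2) ℂ := mat2 1 0 0 Complex.I

/-- The gate `T`. -/
def gateT : Matrix (ZMod 2) (ZMod 2) ℂ := mat2 1 0 0 (Complex.exp (Complex.I * Real.pi / 4))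

/-- The Hadamard gate `H`. -/
def gateH : Matrix (ZMod 2) (ZMod 2) ℂ := ((Real.sqrt 2 : ℂ)⁻¹) • mat2 1 1 1 (-1)

/-- The rotation `R_x(θ) = exp (-iθX/2)`. -/
def gateRx (θ : ℝ) : Matrix (ZMod 2) (ZMod 2) ℂ :=
  mat2 (Real.cos (θ / 2)) (-Complex.I * Real.sin (θ / 2))
    (-Complex.I * Real.sin (θ / 2)) (Real.cos (θ / 2))

/-- The principal `2^i`-th root `V_i` of NOT: eigenvalue `1` on `(1, 1)` and eigenvalue
`exp (iπ / 2^i)` on `(1, -1)`. -/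
def gateV (i : ℕ) : Matrix (ZMod 2) (ZMod 2) ℂ :=
  let ω : ℂ := Complex.exp (Complex.I * Real.pi / 2 ^ i)
  mat2 ((1 + ω) / 2) ((1 - ω) / 2) ((1 - ω) / 2) ((1 + ω) / 2)

/-- The one-qubit gate `G` on the wire `q` of `n` wires. -/
def onWire {n : ℕ} (q : Fin n) (G : Matrix (ZMod 2) (ZMod 2) ℂ) : Matrix (Bits n) (Bits n) ℂ :=
  Matrix.of fun y x => if ∀ j, j ≠ q → y j = x j then G (y q) (x q) else 0

/-- The gate `G` on the wire `t`, controlled by the wire `c`. -/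
def controlled {n : ℕ} (c t : Fin n) (G : Matrix (ZMod 2) (ZMod 2) ℂ) :
    Matrix (Bits n) (Bits n) ℂ :=
  Matrix.of fun y x => if x c = 1 then onWire t G y x else if y = x then 1 else 0

/-! ### Elementary gates and circuits -/

/-- The angles `π, ±π/2, ±π/4, …, ±π/2^(n-3)`. -/
def rxAngles (n : ℕ) : Set ℝ :=
  {θ | ∃ k : ℕ, k + 3 ≤ n ∧ (θ = Real.pi / 2 ^ k ∨ (1 ≤ k ∧ θ = -(Real.pi / 2 ^ k)))}

/-- The elementary gates on `n` wires, together with the wires on which they act: NOT, `S`, `T`,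
`H`, CNOT, controlled-`R_x(θ)` for `θ ∈ {π, ±π/2, …, ±π/2^(n-3)}`, and controlled-`V_i` and
controlled-`V_i†` for `1 ≤ i ≤ n - 2`. -/
inductive Gate (n : ℕ) : Type
  | not (q : Fin n) : Gate n
  | s (q : Fin n) : Gate n
  | t (q : Fin n) : Gate n
  | h (q : Fin n) : Gate n
  | cnot (c q : Fin n) (hcq : c ≠ q) : Gate n
  | crx (θ : ℝ) (hθ : θ ∈ rxAngles n) (c q : Fin n) (hcq : c ≠ q) : Gate n
  | cv (i : ℕ) (hi : 1 ≤ i) (hin : i + 2 ≤ n) (c q : Fin n) (hcq : c ≠ q) : Gate n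
  | cvdag (i : ℕ) (hi : 1 ≤ i) (hin : i + 2 ≤ n) (c q : Fin n) (hcq : c ≠ q) : Gate n

/-- The `2^n × 2^n` matrix of an elementary gate. -/
def Gate.matrix {n : ℕ} : Gate n → Matrix (Bits n) (Bits n) ℂ
  | .not q => onWire q gateX
  | .s q => onWire q gateS
  | .t q => onWire q gateT
  | .h q => onWire q gateH
  | .cnot c q _ => controlled c q gateX
  | .crx θ _ c q _ => controlled c q (gateRx θ)
  | .cv i _ _ c q _ => controlled c q (gateV i)
  | .cvdag i _ _ c q _ => controlled c q (gateV i).conjTranspose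

/-- The matrix of a circuit on exactly `n` wires (no ancillary wires): a list of elementary gates,
applied from left to right. The number of gates is the length of the list. -/
def circuitMatrix {n : ℕ} : List (Gate n) → Matrix (Bits n) (Bits n) ℂ
  | [] => 1
  | g :: c => circuitMatrix c * g.matrix

/-- The circuit `c` implements the permutation matrix of `σ` (exactly, no global phase). -/
def Implements {n : ℕ} (c : List (Gate n)) (σ : Equiv.Perm (Bits n)) : Prop :=
  circuitMatrix c = permMatrix σ

end

/-! ### Controlled NOTs and linear reversible maps, as permutations of the basis states -/

/-- `g` flips the bit `t` if the bits in `ctrl` agree with `pat`, and does nothing otherwise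
(a controlled NOT with `ctrl.card` control bits). -/
def IsMCNot {n : ℕ} (ctrl : Finset (Fin n)) (pat : Bits n) (t : Fin n)
    (g : Equiv.Perm (Bits n)) : Prop :=
  t ∉ ctrl ∧ ∀ x, g x = if ∀ j ∈ ctrl, x j = pat j then Function.update x t (x t + 1) else x

/-- A CNOT gate. -/
def IsCNot {n : ℕ} (g : Equiv.Perm (Bits n)) : Prop :=
  ∃ c t : Fin n, IsMCNot {c} (fun _ => 1) t g

/-- A Toffoli gate. -/
def IsToffoli {n : ℕ} (g : Equiv.Perm (Bits n)) : Prop :=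
  ∃ c₁ c₂ t : Fin n, c₁ ≠ c₂ ∧ IsMCNot {c₁, c₂} (fun _ => 1) t g

/-- A linear reversible map. -/
def IsLinearRev {n : ℕ} (g : Equiv.Perm (Bits n)) : Prop :=
  ∀ x y, g (x + y) = g x + g y

/-- The bit string whose only `1` is at position `j` (counted from `0`). -/
def unitBits (n j : ℕ) : Bits n := fun q => if q.val = j then 1 else 0

/-- The bit string `10⋯0` of length `n - m` followed by the `m`-bit binary expansion of `j`. -/
def swapBits (n m j : ℕ) : Bits n := fun q =>
  if q.val < n - m then (if q.val = 0 then 1 else 0)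
  else (if j.testBit (n - 1 - q.val) then 1 else 0)

/-- The NOT on the last bit, controlled by the first `n - m` bits being `10⋯0`. -/
def IsMainSwap {n : ℕ} (m : ℕ) (g : Equiv.Perm (Bits n)) : Prop :=
  ∃ t : Fin n, t.val + 1 = n ∧
    IsMCNot (Finset.univ.filter fun j : Fin n => j.val < n - m) (unitBits n 0) t g

/-! ### One step of the procedure -/

/-- The linear-independence condition on pairs `(a 0, b 0), …, (a (k-1), b (k-1))`: for suitable
`z`, with `z 0 = b 0`, the vectors `a 0, z 0, …, a (k-1), z (k-1)` are linearly independent over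
`𝔽₂`, and neither `a t` nor `b t` is in the span of `a 0, z 0, …, a (t-1), z (t-1)`. -/
def IndependentPairs {n k : ℕ} (a b : Fin k → Bits n) : Prop :=
  ∃ z : Fin k → Bits n,
    LinearIndependent (ZMod 2) (Sum.elim a z) ∧
    (∀ t, t.val = 0 → z t = b t) ∧
    ∀ t, a t ∉ Submodule.span (ZMod 2) (a '' Set.Iio t ∪ z '' Set.Iio t) ∧
      b t ∉ Submodule.span (ZMod 2) (a '' Set.Iio t ∪ z '' Set.Iio t)

/-- One step at the current permutation `P`, with `m = ⌊log₂ n⌋ - 1`: `Q` undoes `2^(m-1)` pairs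
`(a t, P (a t))` that satisfy the linear-independence condition, and `Q` is the NOT with `n - m`
controls, conjugated by `M * E`. Here `E` maps the pairs to unit vectors and consists of two linear
reversible maps with fewer than `2^(m-1)` Toffoli gates between them, `M` maps these unit
vectors to the states on which the controlled NOT acts and is a product of at most `K n log n` CNOT
and Toffoli gates, and `M * E` has at most `K n² / log n` elementary gates. -/
def IsStep {n : ℕ} (K : ℝ) (P Q : Equiv.Perm (Bits n)) : Prop :=
  let m : ℕ := Nat.log 2 n - 1
  ∃ (a : Fin (2 ^ (m - 1)) → Bits n) (E M T : Equiv.Perm (Bits n)),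
    -- the pairs, and the action of `Q`
    (∀ t, P (a t) ≠ a t) ∧
    IndependentPairs a (fun t => P (a t)) ∧
    (∀ t, Q (a t) = P (a t) ∧ Q (P (a t)) = a t) ∧
    (∀ x, (∀ t, x ≠ a t ∧ x ≠ P (a t)) → Q x = x) ∧
    -- the conjugated controlled NOT
    IsMainSwap m T ∧
    Q = (M * E)⁻¹ * T * (M * E) ∧
    -- the conjugating map
    (∀ t, E (a t) = unitBits n (2 * t.val) ∧ E (P (a t)) = unitBits n (2 * t.val + 1)) ∧
    (∃ (R₁ R₂ : Equiv.Perm (Bits n)) (w : List (Equiv.Perm (Bits n))),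
      IsLinearRev R₁ ∧ IsLinearRev R₂ ∧ (∀ g ∈ w, IsToffoli g) ∧ w.length < 2 ^ (m - 1) ∧
      E = R₂ * w.prod * R₁) ∧
    (∀ j < 2 ^ m, M (unitBits n j) = swapBits n m j) ∧
    (∃ w : List (Equiv.Perm (Bits n)), (∀ g ∈ w, IsCNot g ∨ IsToffoli g) ∧
      (w.length : ℝ) ≤ K * (n * Real.log n) ∧ M = w.prod) ∧
    (∃ c : List (Gate n), Implements c (M * E) ∧ (c.length : ℝ) ≤ K * (n ^ 2 / Real.log n))

/-- `Procedure K P c P' d`: starting from `P`, a sequence of `d` steps, each replacing the current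
permutation by its product with some `Q` as above that is implemented by at most `K n² / log n`
elementary gates, ends at `P'`; `c` is the concatenation of the circuits of all steps. -/
inductive Procedure {n : ℕ} (K : ℝ) :
    Equiv.Perm (Bits n) → List (Gate n) → Equiv.Perm (Bits n) → ℕ → Prop
  | done (P : Equiv.Perm (Bits n)) : Procedure K P [] P 0
  | step {P Q P' : Equiv.Perm (Bits n)} {c₁ c : List (Gate n)} {d : ℕ}
      (hstep : IsStep K P Q) (himpl : Implements c₁ Q)
      (hcost : (c₁.length : ℝ) ≤ K * (n ^ 2 / Real.log n))
      (hrest : Procedure K (Q * P) c P' d) : Procedure K P (c₁ ++ c) P' (d + 1)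

end RevSynth

/-! Let `L = Nat.log 2 n`, `m = L - 1`, `k = 2 ^ (m - 1)`, so that `4 * k ≤ n < 8 * k`. As long as
the current permutation `f` moves more than `2 ^ (2 * k - 1)` states, one round composes it with a
product `Q` of `k` disjoint transpositions `(a t, f (a t))`. Afterwards every `a t` is fixed and no
new state is moved, so the support shrinks by at least `k`. There are thus at most `2 ^ n / k ≤ 8 *
2 ^ n / n` rounds, and at the end the support is at most `2 ^ (2 * k - 1) ≤ 2 ^ (n / 2 - 1)`.

The gain is that all `k` transpositions are performed by one multiply controlled NOT, conjugated by
a cheap map. The pairs are found greedily (`exists_pairSequence`): a span of dimension at most `2 *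
k - 2`, together with its preimage under `f`, is too small to contain the support. A linear map
sends `a t`, `z t` to unit vectors. If `f (a t)` is not `z t`, it differs from `a t` by an earlier
vector, and a single Toffoli gate makes it independent; a second, unitriangular linear map then
straightens all images (`exists_pairMap`). Finally the `2 * k` unit vectors are compressed to binary
addresses on `m` wires (`exists_unaryToBinary`), where flipping the last bit exchanges the partners.

The linear maps dominate the cost: block Gaussian elimination with blocks of width about half of
`log₂ n` uses `O(n² / log n)` CNOT gates (`words_of_isLinearRev_log`). The controlled NOT is linear
in `n` because a free wire can be borrowed (`words_mcNot`), and the compression costs `O(n log n)`.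
So a round costs `O(n² / log n)` and the total is `O(2 ^ n n / log n)`.

For `n ≤ 7` the inverse of `P` itself is implemented: the gates generate all permutations
(`implementable_eq_top`), and the finitely many circuit sizes are absorbed in the constant. -/

namespace RevSynth

/-! ### Words in a set of permutations. -/

/-- `σ` is a product of at most `N` permutations from `G`. -/
def Words {n : ℕ} (G : Set (Equiv.Perm (Bits n))) (N : ℕ) (σ : Equiv.Perm (Bits n)) : Prop :=
  ∃ w : List (Equiv.Perm (Bits n)), (∀ g ∈ w, g ∈ G) ∧ w.length ≤ N ∧ w.prod = σ

namespace Words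

variable {n : ℕ} {G H : Set (Equiv.Perm (Bits n))} {N N' : ℕ} {σ τ : Equiv.Perm (Bits n)}

theorem one : Words G N 1 := ⟨[], by simp, by simp, rfl⟩

theorem of_mem (h : σ ∈ G) : Words G 1 σ := ⟨[σ], by simpa, by simp, by simp⟩

theorem mono (h : Words G N σ) (hN : N ≤ N') : Words G N' σ := by
  obtain ⟨w, h1, h2, h3⟩ := h
  exact ⟨w, h1, h2.trans hN, h3⟩

theorem mono_set (h : Words G N σ) (hG : G ⊆ H) : Words H N σ := by
  obtain ⟨w, h1, h2, h3⟩ := h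
  exact ⟨w, fun g hg => hG (h1 g hg), h2, h3⟩

theorem mul (h : Words G N σ) (h' : Words G N' τ) : Words G (N + N') (σ * τ) := by
  obtain ⟨w, h1, h2, h3⟩ := h
  obtain ⟨w', h1', h2', h3'⟩ := h'
  refine ⟨w ++ w', ?_, by simp; omega, by simp [h3, h3']⟩
  intro g hg
  rcases List.mem_append.1 hg with hg | hg
  exacts [h1 g hg, h1' g hg]

theorem inv (hG : ∀ g ∈ G, g⁻¹ ∈ G) (h : Words G N σ) : Words G N σ⁻¹ := by
  obtain ⟨w, h1, h2, h3⟩ := h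
  refine ⟨(w.map fun g => g⁻¹).reverse, ?_, by simpa, by rw [← h3, List.prod_inv_reverse]⟩
  intro g hg
  simp only [List.mem_reverse, List.mem_map] at hg
  obtain ⟨g', hg', rfl⟩ := hg
  exact hG _ (h1 _ hg')

end Words

/-! ### CNOT networks for copying and adding parities. -/

section Gates

variable {n : ℕ}

/-- The NOT on `t`, controlled by the bits in `ctrl` agreeing with `pat`. -/
def mcNot (ctrl : Finset (Fin n)) (pat : Bits n) (t : Fin n) (ht : t ∉ ctrl) :
    Equiv.Perm (Bits n) :=
  Function.Involutive.toPerm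
    (fun x => if ∀ j ∈ ctrl, x j = pat j then Function.update x t (x t + 1) else x) (by
      intro x
      have key : ∀ j ∈ ctrl, Function.update x t (x t + 1) j = x j := fun j hj =>
        Function.update_of_ne (by rintro rfl; exact ht hj) _ _
      by_cases h : ∀ j ∈ ctrl, x j = pat j
      · have h' : ∀ j ∈ ctrl, Function.update x t (x t + 1) j = pat j := fun j hj =>
          (key j hj).trans (h j hj)
        simp only [if_pos h, if_pos h']
        ext j
        by_cases hj : j = t
        · subst hj
          simp [add_assoc, CharTwo.add_self_eq_zero]
        · simp [hj]
      · simp only [if_neg h])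

theorem isMCNot_mcNot (ctrl : Finset (Fin n)) (pat : Bits n) (t : Fin n) (ht : t ∉ ctrl) :
    IsMCNot ctrl pat t (mcNot ctrl pat t ht) := ⟨ht, fun _ => rfl⟩

theorem IsMCNot.eq_mcNot {ctrl : Finset (Fin n)} {pat : Bits n} {t : Fin n}
    {g : Equiv.Perm (Bits n)} (h : IsMCNot ctrl pat t g) : g = mcNot ctrl pat t h.1 :=
  Equiv.ext h.2

theorem mcNot_inv (ctrl : Finset (Fin n)) (pat : Bits n) (t : Fin n) (ht : t ∉ ctrl) :
    (mcNot ctrl pat t ht)⁻¹ = mcNot ctrl pat t ht := rfl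

theorem zmod_two_eq_zero_or_one (a : ZMod 2) : a = 0 ∨ a = 1 := by
  revert a; decide

theorem mcNot_one_apply (ctrl : Finset (Fin n)) (t : Fin n) (ht : t ∉ ctrl) (x : Bits n) :
    mcNot ctrl (fun _ => 1) t ht x = fun i => x i + if i = t then ∏ j ∈ ctrl, x j else 0 := by
  change (if ∀ j ∈ ctrl, x j = 1 then Function.update x t (x t + 1) else x) = _
  by_cases h : ∀ j ∈ ctrl, x j = 1
  · rw [if_pos h, Finset.prod_eq_one h]
    ext i
    by_cases hi : i = t
    · subst hi; simp
    · simp [hi]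
  · rw [if_neg h]
    push Not at h
    obtain ⟨j, hj, hj'⟩ := h
    rw [Finset.prod_eq_zero hj ((zmod_two_eq_zero_or_one (x j)).resolve_right hj')]
    simp

/-- The CNOT gates. -/
def cnots (n : ℕ) : Set (Equiv.Perm (Bits n)) := {g | IsCNot g}

/-- The CNOT and Toffoli gates. -/
def toffolis (n : ℕ) : Set (Equiv.Perm (Bits n)) := {g | IsCNot g ∨ IsToffoli g}

/-- The NOT, CNOT and Toffoli gates. -/
def simples (n : ℕ) : Set (Equiv.Perm (Bits n)) :=
  {g | (∃ t, IsMCNot ∅ (fun _ => 1) t g) ∨ IsCNot g ∨ IsToffoli g}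

theorem cnots_subset : cnots n ⊆ toffolis n := fun _ h => Or.inl h

theorem toffolis_subset : toffolis n ⊆ simples n := fun _ h => Or.inr h

theorem IsMCNot.inv {ctrl : Finset (Fin n)} {pat : Bits n} {t : Fin n}
    {g : Equiv.Perm (Bits n)} (h : IsMCNot ctrl pat t g) : IsMCNot ctrl pat t g⁻¹ := by
  rw [h.eq_mcNot, mcNot_inv]
  exact isMCNot_mcNot ..

theorem inv_mem_cnots (g : Equiv.Perm (Bits n)) (hg : g ∈ cnots n) : g⁻¹ ∈ cnots n := by
  obtain ⟨c, t, h⟩ := hg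
  exact ⟨c, t, h.inv⟩

theorem inv_mem_toffolis (g : Equiv.Perm (Bits n)) (hg : g ∈ toffolis n) : g⁻¹ ∈ toffolis n := by
  rcases hg with hg | ⟨c, c', t, hc, h⟩
  · exact Or.inl (inv_mem_cnots g hg)
  · exact Or.inr ⟨c, c', t, hc, h.inv⟩

theorem inv_mem_simples (g : Equiv.Perm (Bits n)) (hg : g ∈ simples n) : g⁻¹ ∈ simples n := by
  rcases hg with ⟨t, h⟩ | hg
  · exact Or.inl ⟨t, h.inv⟩
  · exact Or.inr (inv_mem_toffolis g hg)

theorem exists_cnot {c t : Fin n} (h : c ≠ t) : ∃ σ ∈ cnots n,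
    ∀ x, σ x = fun i => x i + if i = t then x c else 0 :=
  ⟨mcNot {c} (fun _ => 1) t (by simpa using h.symm), ⟨c, t, isMCNot_mcNot ..⟩, fun x => by
    rw [mcNot_one_apply, Finset.prod_singleton]⟩

theorem exists_toffoli {c c' t : Fin n} (h : c ≠ t) (h' : c' ≠ t) (hc : c ≠ c') :
    ∃ σ, IsToffoli σ ∧ ∀ x, σ x = fun i => x i + if i = t then x c * x c' else 0 :=
  ⟨mcNot {c, c'} (fun _ => 1) t (by simpa using ⟨h.symm, h'.symm⟩),
    ⟨c, c', t, hc, isMCNot_mcNot ..⟩, fun x => by rw [mcNot_one_apply, Finset.prod_pair hc]⟩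

theorem exists_fanOut (s : Fin n) (F : Finset (Fin n)) (hs : s ∉ F) :
    ∃ σ, Words (cnots n) F.card σ ∧ ∀ x, σ x = fun i => x i + if i ∈ F then x s else 0 := by
  induction F using Finset.induction_on with
  | empty => exact ⟨1, Words.one, fun x => by simp⟩
  | insert t F ht ih =>
    simp only [Finset.mem_insert, not_or] at hs
    obtain ⟨σ, hσ, h⟩ := ih hs.2
    obtain ⟨τ, hτ, h'⟩ := exists_cnot hs.1
    refine ⟨τ * σ, ((Words.of_mem hτ).mul hσ).mono
      (by rw [Finset.card_insert_of_notMem ht]; omega), fun x => ?_⟩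
    rw [Equiv.Perm.mul_apply, h, h']
    ext i
    by_cases hi : i = t
    · subst hi; simp [ht, hs.2]
    · simp [hi]

theorem exists_fanIn (s : Fin n) (F : Finset (Fin n)) (hs : s ∉ F) :
    ∃ σ, Words (cnots n) F.card σ ∧ ∀ x, σ x = fun i => x i + if i = s then ∑ j ∈ F, x j else 0 := by
  induction F using Finset.induction_on with
  | empty => exact ⟨1, Words.one, fun x => by simp⟩
  | insert t F ht ih =>
    simp only [Finset.mem_insert, not_or] at hs
    obtain ⟨σ, hσ, h⟩ := ih hs.2
    obtain ⟨τ, hτ, h'⟩ := exists_cnot (Ne.symm hs.1)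
    refine ⟨τ * σ, ((Words.of_mem hτ).mul hσ).mono
      (by rw [Finset.card_insert_of_notMem ht]; omega), fun x => ?_⟩
    rw [Equiv.Perm.mul_apply, h, h']
    ext i
    by_cases hi : i = s
    · subst hi
      simp [Finset.sum_insert ht, Ne.symm hs.1]
      ring
    · simp [hi]

/-- Adding the parity of a set `q` of wires to all wires of a disjoint set `F`. -/
theorem exists_parityFanOut (q F : Finset (Fin n)) (hq : Disjoint q F) :
    ∃ σ, Words (cnots n) (2 * q.card + F.card) σ ∧
      ∀ x, σ x = fun i => x i + if i ∈ F then ∑ j ∈ q, x j else 0 := by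
  rcases q.eq_empty_or_nonempty with rfl | ⟨s, hs⟩
  · exact ⟨1, Words.one, fun x => by simp⟩
  -- The parity is gathered on one wire `s` of `q`, copied to `F`, and the gathering is undone by
  -- repeating it.
  obtain ⟨σ, hσ, h⟩ := exists_fanIn s (q.erase s) (by simp)
  obtain ⟨τ, hτ, h'⟩ := exists_fanOut s F (Finset.disjoint_left.1 hq hs)
  have hc := Finset.card_erase_le (s := q) (a := s)
  refine ⟨σ * (τ * σ), (hσ.mul (hτ.mul hσ)).mono (by omega), fun x => ?_⟩
  rw [Equiv.Perm.mul_apply, Equiv.Perm.mul_apply, h, h', h]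
  have hsum : ∑ j ∈ q, x j = x s + ∑ j ∈ q.erase s, x j := (Finset.add_sum_erase q _ hs).symm
  ext i
  have hq' : ∀ j ∈ q, j ∉ F := fun j hj => Finset.disjoint_left.1 hq hj
  have hsum' : ∑ j ∈ q.erase s, ((x j + if j = s then ∑ j ∈ q.erase s, x j else 0) +
      if j ∈ F then x s + (if s = s then ∑ j ∈ q.erase s, x j else 0) else 0) =
      ∑ j ∈ q.erase s, x j := by
    refine Finset.sum_congr rfl fun j hj => ?_
    rw [Finset.mem_erase] at hj
    simp [hj.1, hq' j hj.2]
  simp only at hsum' ⊢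
  rw [hsum']
  by_cases hi : i = s
  · subst hi
    simp [hq' i hs, add_assoc, CharTwo.add_self_eq_zero]
  · simp [hi, hsum]

/-- Adding to each wire outside a block `S` a parity of wires of `S`: wires receiving the same
parity are treated together. -/
theorem exists_blockAdd (S : Finset (Fin n)) (φ : Fin n → Finset (Fin n)) (hφ : ∀ i, φ i ⊆ S) :
    ∃ σ, Words (cnots n) (2 * S.card * 2 ^ S.card + n) σ ∧
      ∀ x, σ x = fun i => x i + if i ∈ S then 0 else ∑ j ∈ φ i, x j := by
  -- `𝒬` is the family of parities already served. Each parity is computed once, for `2 * S.card`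
  -- gates, and the sets of wires receiving different parities are disjoint, so all copies together
  -- cost at most `n`.
  have key : ∀ 𝒬 ⊆ S.powerset, ∃ σ, Words (cnots n)
      (2 * S.card * 𝒬.card + (Finset.univ.filter fun i => i ∉ S ∧ φ i ∈ 𝒬).card) σ ∧
      ∀ x, σ x = fun i => x i + if i ∉ S ∧ φ i ∈ 𝒬 then ∑ j ∈ φ i, x j else 0 := by
    intro 𝒬
    induction 𝒬 using Finset.induction_on with
    | empty => exact fun _ => ⟨1, Words.one, fun x => by simp⟩
    | insert q 𝒬 hq ih =>
      intro h𝒬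
      obtain ⟨hqS, h𝒬'⟩ := Finset.insert_subset_iff.1 h𝒬
      rw [Finset.mem_powerset] at hqS
      obtain ⟨σ, hσ, h⟩ := ih h𝒬'
      obtain ⟨τ, hτ, h'⟩ := exists_parityFanOut q (Finset.univ.filter fun i => i ∉ S ∧ φ i = q)
        (by
          rw [Finset.disjoint_left]
          intro j hj hj'
          exact (Finset.mem_filter.1 hj').2.1 (hqS hj))
      refine ⟨τ * σ, (hτ.mul hσ).mono ?_, fun x => ?_⟩
      · have e : (Finset.univ.filter fun i => i ∉ S ∧ φ i ∈ insert q 𝒬) =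
            (Finset.univ.filter fun i => i ∉ S ∧ φ i = q) ∪
            (Finset.univ.filter fun i => i ∉ S ∧ φ i ∈ 𝒬) := by
          ext i; simp; tauto
        rw [e, Finset.card_union_of_disjoint, Finset.card_insert_of_notMem hq]
        · have := Finset.card_le_card hqS
          nlinarith
        · rw [Finset.disjoint_left]
          intro j hj hj'
          simp only [Finset.mem_filter, Finset.mem_univ, true_and] at hj hj'
          exact hq (hj.2 ▸ hj'.2)
      · rw [Equiv.Perm.mul_apply, h, h']
        ext i
        have hs : ∑ j ∈ q, (x j + if j ∉ S ∧ φ j ∈ 𝒬 then ∑ j ∈ φ j, x j else 0) =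
            ∑ j ∈ q, x j := by
          refine Finset.sum_congr rfl fun j hj => ?_
          simp [hqS hj]
        rw [hs]
        by_cases hi : i ∈ S
        · simp [hi]
        · by_cases hiq : φ i = q
          · subst hiq
            simp [hi, hq]
          · simp [hi, hiq]
  obtain ⟨σ, hσ, h⟩ := key S.powerset le_rfl
  refine ⟨σ, hσ.mono ?_, fun x => ?_⟩
  · rw [Finset.card_powerset]
    have := Finset.card_le_univ (Finset.univ.filter fun i => i ∉ S ∧ φ i ∈ S.powerset)
    rw [Fintype.card_fin] at this
    omega
  · rw [h]
    ext i
    by_cases hi : i ∈ S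
    · simp [hi]
    · simp [hi, hφ i]

end Gates

/-! ### Linear reversible maps by block Gaussian elimination. -/

section Linear

variable {n : ℕ}

/-- The standard basis vector at position `c`. -/
abbrev stdVec (c : Fin n) : Bits n := Pi.single c 1

theorem IsLinearRev.mul {g h : Equiv.Perm (Bits n)} (hg : IsLinearRev g) (hh : IsLinearRev h) :
    IsLinearRev (g * h) := fun x y => by
  simp only [Equiv.Perm.mul_apply]; rw [hh, hg]

theorem isLinearRev_one : IsLinearRev (1 : Equiv.Perm (Bits n)) := fun _ _ => rfl

/-- A linear reversible map as a linear equivalence. -/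
def IsLinearRev.toLinearEquiv {g : Equiv.Perm (Bits n)} (hg : IsLinearRev g) :
    Bits n ≃ₗ[ZMod 2] Bits n :=
  { g with
    map_add' := hg
    map_smul' := fun c x => by
      have h0 : g 0 = 0 := by simpa using hg 0 0
      rcases zmod_two_eq_zero_or_one c with rfl | rfl <;> simp [h0] }

theorem IsLinearRev.toLinearEquiv_apply {g : Equiv.Perm (Bits n)} (hg : IsLinearRev g)
    (x : Bits n) : hg.toLinearEquiv x = g x := rfl

theorem IsLinearRev.map_sum_smul {g : Equiv.Perm (Bits n)} (hg : IsLinearRev g)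
    (F : Finset (Fin n)) (a : Fin n → ZMod 2) (v : Fin n → Bits n) :
    g (∑ c ∈ F, a c • v c) = ∑ c ∈ F, a c • g (v c) := by
  simp only [← hg.toLinearEquiv_apply, map_sum, map_smul]

theorem eq_sum_stdVec (x : Bits n) : x = ∑ c, x c • stdVec c := by
  ext i
  simp [Finset.sum_apply, Pi.single_apply]

theorem IsLinearRev.eq_one {g : Equiv.Perm (Bits n)} (hg : IsLinearRev g)
    (h : ∀ c, g (stdVec c) = stdVec c) : g = 1 := by
  ext1 x
  conv_lhs => rw [eq_sum_stdVec x]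
  rw [hg.map_sum_smul]
  simp only [h]
  exact (eq_sum_stdVec x).symm

theorem isLinearRev_of_apply {σ : Equiv.Perm (Bits n)} (p : Fin n → Prop) [DecidablePred p]
    (F : Fin n → Finset (Fin n))
    (h : ∀ x, σ x = fun i => x i + if p i then ∑ j ∈ F i, x j else 0) : IsLinearRev σ := by
  intro x y
  simp only [h]
  ext i
  by_cases hp : p i
  · simp [hp, Finset.sum_add_distrib]; ring
  · simp [hp]

/-- Gauss–Jordan elimination restricted to the block `S × S`, adding one column `c₀` at a time
without disturbing the finished columns `C`. A new column costs one CNOT for the pivot and at most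
`S.card` each for its row and its column. -/
theorem exists_blockIdentity (C S : Finset (Fin n)) (hCS : Disjoint C S)
    (g : Equiv.Perm (Bits n)) (hg : IsLinearRev g) (hC : ∀ c ∈ C, g (stdVec c) = stdVec c) :
    ∃ σ, Words (cnots n) (2 * S.card * S.card) σ ∧ IsLinearRev σ ∧
      (∀ c ∈ C, σ (stdVec c) = stdVec c) ∧
      ∀ c ∈ S, ∀ i ∈ S, σ (g (stdVec c)) i = if i = c then 1 else 0 := by
  induction S using Finset.induction_on with
  | empty => exact ⟨1, Words.one, isLinearRev_one, fun _ _ => rfl, by simp⟩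
  | insert c₀ S hc₀ ih =>
    rw [Finset.disjoint_insert_right] at hCS
    obtain ⟨σ, hσ, hσl, hσC, hσS⟩ := ih hCS.2
    set e := fun c => σ (g (stdVec c)) with he
    have hl : IsLinearRev (σ * g) := hσl.mul hg
    have heC : ∀ c ∈ C, e c = stdVec c := fun c hc => by simp only [he, hC c hc, hσC c hc]
    -- The image `u` of `v` is the new column reduced by the columns of `S`, so it vanishes on the
    -- rows in `S`.
    set v : Bits n := stdVec c₀ + ∑ c ∈ S, e c₀ c • stdVec c with hv
    set u : Bits n := e c₀ + ∑ c ∈ S, e c₀ c • e c with hu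
    have huv : (σ * g) v = u := by
      rw [hv, hl, hl.map_sum_smul]; rfl
    have huS : ∀ i ∈ S, u i = 0 := by
      intro i hi
      have : ∑ c ∈ S, (e c₀ c • e c) i = e c₀ i := by
        rw [Finset.sum_congr rfl fun c hc => by
          rw [Pi.smul_apply, show e c i = if i = c then 1 else 0 from hσS c hc i hi]]
        simp [hi]
      rw [hu, Pi.add_apply, Finset.sum_apply, this, CharTwo.add_self_eq_zero]
    -- If `u` were supported in `C`, it would be the image of a vector supported in `C`; injectivity
    -- forbids this because `v` has entry `1` at `c₀ ∉ C`. The row `i` found may be `c₀` itself.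
    obtain ⟨i, hiC, hi⟩ : ∃ i, i ∉ C ∧ u i = 1 := by
      by_contra! hcon
      have h1 : u = (σ * g) (∑ c ∈ C, u c • stdVec c) := by
        rw [hl.map_sum_smul]
        have : ∀ c ∈ C, u c • (σ * g) (stdVec c) = u c • stdVec c := fun c hc => by
          rw [show (σ * g) (stdVec c) = stdVec c from heC c hc]
        rw [Finset.sum_congr rfl this]
        ext i
        rw [Finset.sum_apply]
        by_cases hi : i ∈ C
        · simp [Pi.single_apply, hi]
        · have := (zmod_two_eq_zero_or_one (u i)).resolve_right (hcon i hi)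
          simp [Pi.single_apply, hi, this]
      rw [← huv] at h1
      have h2 := congrFun ((σ * g).injective h1) c₀
      simp [hv, hc₀, hCS.1, Finset.sum_apply, Pi.single_apply] at h2
    have hiS : i ∉ S := fun h => by rw [huS i h] at hi; exact zero_ne_one hi
    -- make the new pivot nonzero
    obtain ⟨τ₁, hτ₁, hτ₁l, hτ₁C, hτ₁u, hτ₁o⟩ : ∃ τ₁, Words (cnots n) 1 τ₁ ∧ IsLinearRev τ₁ ∧
        (∀ c ∈ C, τ₁ (stdVec c) = stdVec c) ∧ τ₁ u c₀ = 1 ∧ ∀ x, ∀ j ≠ c₀, τ₁ x j = x j := by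
      rcases zmod_two_eq_zero_or_one (u c₀) with h0 | h0
      · have hne : i ≠ c₀ := by rintro rfl; rw [hi] at h0; exact one_ne_zero h0
        obtain ⟨τ, hτ, h⟩ := exists_cnot hne
        refine ⟨τ, .of_mem hτ, isLinearRev_of_apply (· = c₀) (fun _ => {i}) (by simpa using h),
          fun c hc => ?_, ?_, fun x j hj => ?_⟩
        · rw [h]
          have : i ≠ c := by rintro rfl; exact hiC hc
          ext j; simp [Pi.single_apply, this]
        · rw [h]; simp [h0, hi]
        · rw [h]; simp [hj]
      · exact ⟨1, Words.one, isLinearRev_one, fun _ _ => rfl, h0, fun _ _ _ => rfl⟩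
    -- clear the row of the new pivot
    obtain ⟨τ₂, hτ₂, h₂⟩ := exists_fanIn c₀ (S.filter fun c => τ₁ (e c) c₀ = 1) (by simp [hc₀])
    have hl₂ : IsLinearRev τ₂ := isLinearRev_of_apply (· = c₀) (fun _ => _) h₂
    have hrow : ∀ c ∈ S, τ₂ (τ₁ (e c)) c₀ = 0 := by
      intro c hc
      rw [h₂]
      have : ∑ j ∈ S.filter (fun c => τ₁ (e c) c₀ = 1), τ₁ (e c) j = τ₁ (e c) c₀ := by
        rw [Finset.sum_filter]
        rw [Finset.sum_congr rfl fun j hj => by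
          rw [hτ₁o _ j (by rintro rfl; exact hc₀ hj), show e c j = if j = c then 1 else 0 from
            hσS c hc j hj]]
        rcases zmod_two_eq_zero_or_one (τ₁ (e c) c₀) with h0 | h0
        · rw [h0]
          refine Finset.sum_eq_zero fun j hj => ?_
          by_cases hjc : j = c
          · subst hjc; simp [h0]
          · simp [hjc]
        · rw [h0, Finset.sum_eq_single c]
          · simp [h0]
          · intro j _ hj; simp [hj]
          · exact fun h => absurd hc h
      simp only [if_true, this, CharTwo.add_self_eq_zero]
    have ho₂ : ∀ x, ∀ j ≠ c₀, τ₂ x j = x j := fun x j hj => by rw [h₂]; simp [hj]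
    have hC₂ : ∀ c ∈ C, τ₂ (stdVec c) = stdVec c := by
      intro c hc
      rw [h₂]
      have : ∑ j ∈ S.filter (fun c => τ₁ (e c) c₀ = 1), (stdVec c : Bits n) j = 0 := by
        refine Finset.sum_eq_zero fun j hj => ?_
        have : j ≠ c := by
          rintro rfl; exact Finset.disjoint_left.1 hCS.2 hc (Finset.mem_filter.1 hj).1
        simp [this]
      ext j; simp only [this]; simp
    -- Since `u` vanishes on `S`, clearing the row leaves its entry at `c₀` equal to `1`. The
    -- columns of `S` now have entry `0` there, so `e c₀` has the same entry as `u`.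
    have hpivot : τ₂ (τ₁ (e c₀)) c₀ = 1 := by
      have h1 : τ₂ (τ₁ u) c₀ = 1 := by
        rw [h₂]
        have : ∑ j ∈ S.filter (fun c => τ₁ (e c) c₀ = 1), τ₁ u j = 0 :=
          Finset.sum_eq_zero fun j hj => by
            have hj := (Finset.mem_filter.1 hj).1
            rw [hτ₁o _ j (ne_of_mem_of_not_mem hj hc₀), huS j hj]
        simp only [this, hτ₁u]; simp
      rw [hu, hτ₁l, hτ₁l.map_sum_smul, hl₂, hl₂.map_sum_smul, Pi.add_apply, Finset.sum_apply,
        Finset.sum_eq_zero, add_zero] at h1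
      · exact h1
      · intro c hc
        rw [Pi.smul_apply, hrow c hc, smul_zero]
    -- clear the column of the new pivot
    obtain ⟨τ₃, hτ₃, h₃⟩ := exists_fanOut c₀ (S.filter fun c => e c₀ c = 1) (by simp [hc₀])
    have hl₃ : IsLinearRev τ₃ :=
      isLinearRev_of_apply (· ∈ S.filter fun c => e c₀ c = 1) (fun _ => {c₀}) (by simpa using h₃)
    refine ⟨τ₃ * (τ₂ * (τ₁ * σ)), (hτ₃.mul (hτ₂.mul (hτ₁.mul hσ))).mono ?_,
      hl₃.mul (hl₂.mul (hτ₁l.mul hσl)), fun c hc => ?_, ?_⟩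
    · have h1 := Finset.card_filter_le S fun c => τ₁ (e c) c₀ = 1
      have h2 := Finset.card_filter_le S fun c => e c₀ c = 1
      rw [Finset.card_insert_of_notMem hc₀]
      nlinarith
    · simp only [Equiv.Perm.mul_apply]
      rw [hσC c hc, hτ₁C c hc, hC₂ c hc, h₃]
      have : c₀ ≠ c := by rintro rfl; exact hCS.1 hc
      ext j; simp [this]
    · intro c hc i hi
      simp only [Equiv.Perm.mul_apply]
      change τ₃ (τ₂ (τ₁ (e c))) i = _
      rw [h₃]
      rw [Finset.mem_insert] at hc hi
      rcases hc with rfl | hc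
      · rcases hi with rfl | hi
        · simp [hc₀, hpivot]
        · have hic : i ≠ c := ne_of_mem_of_not_mem hi hc₀
          simp only [ho₂ _ i hic, hτ₁o _ i hic, hpivot, Finset.mem_filter, hi, true_and, hic,
            if_false]
          rcases zmod_two_eq_zero_or_one (e c i) with h0 | h0 <;> simp [h0, CharTwo.add_self_eq_zero]
      · simp only [hrow c hc]
        rcases hi with rfl | hi
        · have : i ≠ c := by rintro rfl; exact hc₀ hc
          simp [hrow c hc, this]
        · have hic : i ≠ c₀ := ne_of_mem_of_not_mem hi hc₀
          simp only [ho₂ _ i hic, hτ₁o _ i hic, ite_self, add_zero]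
          exact hσS c hc i hi

/-- Once the diagonal block is the identity, any row outside `S`, restricted to the columns of `S`,
is a sum of rows of `S`. Adding this sum to it is a `exists_blockAdd` operation, and it does not
affect the columns in `C`, which vanish on `S`. -/
theorem exists_blockElimination (C S : Finset (Fin n)) (hCS : Disjoint C S)
    (g : Equiv.Perm (Bits n)) (hg : IsLinearRev g) (hC : ∀ c ∈ C, g (stdVec c) = stdVec c) :
    ∃ σ, Words (cnots n) (2 * S.card * S.card + 2 * S.card * 2 ^ S.card + n) σ ∧
      IsLinearRev σ ∧ ∀ c ∈ C ∪ S, σ (g (stdVec c)) = stdVec c := by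
  obtain ⟨σ, hσ, hσl, hσC, hσS⟩ := exists_blockIdentity C S hCS g hg hC
  obtain ⟨τ, hτ, h⟩ := exists_blockAdd S
    (fun i => S.filter fun j => σ (g (stdVec j)) i = 1) (fun i => Finset.filter_subset _ _)
  have hl : IsLinearRev τ := isLinearRev_of_apply (· ∉ S) _ (by simpa using h)
  refine ⟨τ * σ, (hτ.mul hσ).mono (by omega), hl.mul hσl, fun c hc => ?_⟩
  rw [Equiv.Perm.mul_apply, h]
  rcases Finset.mem_union.1 hc with hc | hc
  · rw [hC c hc, hσC c hc]
    ext i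
    rw [Finset.sum_eq_zero]
    · simp
    · intro j hj
      have : j ≠ c := by
        rintro rfl; exact Finset.disjoint_left.1 hCS hc (Finset.mem_filter.1 hj).1
      simp [this]
  · ext i
    by_cases hi : i ∈ S
    · simp only [hi, if_true, add_zero, hσS c hc i hi, Pi.single_apply]
    · have hic : i ≠ c := by rintro rfl; exact hi hc
      have : ∑ j ∈ S.filter (fun j => σ (g (stdVec j)) i = 1), σ (g (stdVec c)) j =
          σ (g (stdVec c)) i := by
        rw [Finset.sum_filter]
        rw [Finset.sum_congr rfl fun j hj => by rw [hσS c hc j hj]]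
        rw [Finset.sum_eq_single c]
        · rcases zmod_two_eq_zero_or_one (σ (g (stdVec c)) i) with h0 | h0 <;> simp [h0]
        · intro j _ hj; simp [hj]
        · exact fun h => absurd hc h
      simp only [hi, if_false, this, CharTwo.add_self_eq_zero]
      simp [hic]

/-- Each elimination round finishes `w` further columns, or all that remain, so `n / w + 1` rounds
reduce `g` to the identity; the circuit found is `g⁻¹`, and CNOT words can be inverted. -/
theorem words_of_isLinearRev (g : Equiv.Perm (Bits n)) (hg : IsLinearRev g) (w : ℕ)
    (hw : 0 < w) :
    Words (cnots n) ((n / w + 1) * (2 * w * w + 2 * w * 2 ^ w + n)) g := by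
  have key : ∀ k, ∃ (C : Finset (Fin n)) (σ : Equiv.Perm (Bits n)),
      Words (cnots n) (k * (2 * w * w + 2 * w * 2 ^ w + n)) σ ∧ IsLinearRev σ ∧
      (∀ c ∈ C, σ (g (stdVec c)) = stdVec c) ∧ (C = Finset.univ ∨ k * w ≤ C.card) := by
    intro k
    induction k with
    | zero => exact ⟨∅, 1, Words.one, isLinearRev_one, by simp, by simp⟩
    | succ k ih =>
      obtain ⟨C, σ, hσ, hσl, hσC, hc⟩ := ih
      obtain ⟨S, hS, hSw, hSC⟩ : ∃ S : Finset (Fin n), Disjoint C S ∧ S.card ≤ w ∧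
          (C ∪ S = Finset.univ ∨ (k + 1) * w ≤ (C ∪ S).card) := by
        rcases hc with rfl | hc
        · exact ⟨∅, by simp, by simp, by simp⟩
        · by_cases hw' : w ≤ Cᶜ.card
          · obtain ⟨S, hS, rfl⟩ := Finset.exists_subset_card_eq hw'
            have hd : Disjoint C S := Finset.disjoint_left.2 fun c hc hs =>
              (Finset.mem_compl.1 (hS hs)) hc
            refine ⟨S, hd, le_rfl, Or.inr ?_⟩
            rw [Finset.card_union_of_disjoint hd, add_mul, one_mul]
            omega
          · exact ⟨Cᶜ, disjoint_compl_right, by omega, Or.inl (Finset.union_compl C)⟩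
      obtain ⟨τ, hτ, hτl, h⟩ := exists_blockElimination C S hS (σ * g) (hσl.mul hg) hσC
      refine ⟨C ∪ S, τ * σ, (hτ.mul hσ).mono ?_, hτl.mul hσl, h, hSC⟩
      have h1 : 2 * S.card * S.card ≤ 2 * w * w := by gcongr
      have h2 : 2 * S.card * 2 ^ S.card ≤ 2 * w * 2 ^ w := by gcongr; norm_num
      rw [add_mul, one_mul]
      omega
  obtain ⟨C, σ, hσ, hσl, hσC, hc⟩ := key (n / w + 1)
  have hC : C = Finset.univ := by
    rcases hc with h | h
    · exact h
    · have h1 := Finset.card_le_univ C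
      rw [Fintype.card_fin] at h1
      have := Nat.lt_div_mul_add (a := n) hw
      rw [add_mul, one_mul] at h
      omega
  have h1 : σ * g = 1 := (hσl.mul hg).eq_one fun c => hσC c (by simp [hC])
  rw [eq_inv_of_mul_eq_one_right h1]
  exact hσ.inv inv_mem_cnots

/-- A linear reversible map needs `O(n² / log n)` CNOT gates. -/
theorem words_of_isLinearRev_log (hn : 8 ≤ n) (g : Equiv.Perm (Bits n)) (hg : IsLinearRev g) :
    ∃ N : ℕ, Words (cnots n) N g ∧ (N : ℝ) ≤ 30 * (n ^ 2 / Real.log n) := by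
  set L := Nat.log 2 n with hL
  have hL3 : 3 ≤ L := Nat.le_log_of_pow_le (by norm_num) (by omega)
  have hn0 : n ≠ 0 := by omega
  have hpow : 2 ^ L ≤ n := Nat.pow_log_le_self 2 hn0
  have hlt : n < 2 ^ (L + 1) := Nat.lt_pow_succ_log_self (by norm_num) n
  -- With half of the logarithm, `2 ^ w * 2 ^ w ≤ n`, so both the elimination inside a block and the
  -- list of parities cost `O(n)`, the same order as the copies.
  set w := L / 2 with hw
  have hw1 : 1 ≤ w := by omega
  have hw2 : 2 ^ w * 2 ^ w ≤ n := by
    rw [← pow_add]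
    exact (Nat.pow_le_pow_right (by norm_num) (by omega)).trans hpow
  have hw3 : w < 2 ^ w := Nat.lt_two_pow_self
  have hcost : 2 * w * w + 2 * w * 2 ^ w + n ≤ 5 * n := by nlinarith
  have hwn : w ≤ n := by nlinarith
  refine ⟨_, words_of_isLinearRev g hg w hw1, ?_⟩
  have hlog : Real.log n ≤ 3 * w := by
    have h1 : Real.log n ≤ (L + 1 : ℕ) * Real.log 2 := by
      rw [← Real.log_pow]
      refine Real.log_le_log (by positivity) ?_
      exact_mod_cast hlt.le
    have h2 : Real.log 2 ≤ 3 / 4 := by have := Real.log_two_lt_d9; linarith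
    have h3 : ((L + 1 : ℕ) : ℝ) * Real.log 2 ≤ (L + 1 : ℕ) * (3 / 4) := by gcongr
    have h4 : (L + 1) * 3 ≤ 12 * w := by omega
    have h5 : (((L + 1) * 3 : ℕ) : ℝ) ≤ (12 * w : ℕ) := by exact_mod_cast h4
    push_cast at h1 h3 h5
    linarith
  have hlog0 : 0 < Real.log n := Real.log_pos (by exact_mod_cast (by omega : 1 < n))
  have hw0 : (0 : ℝ) < w := by exact_mod_cast hw1
  have h1 : ((n / w + 1 : ℕ) : ℝ) ≤ 2 * n / w := by
    push_cast
    have h2 : ((n / w : ℕ) : ℝ) ≤ n / w := Nat.cast_div_le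
    have h3 : (1 : ℝ) ≤ n / w := by
      rw [le_div_iff₀ hw0]; simpa using hwn
    have : (2 * n / w : ℝ) = n / w + n / w := by ring
    linarith
  have h2 : ((2 * w * w + 2 * w * 2 ^ w + n : ℕ) : ℝ) ≤ 5 * n := by exact_mod_cast hcost
  rw [Nat.cast_mul]
  calc _ ≤ (2 * n / w : ℝ) * (5 * n) := by gcongr
    _ = 10 * (n ^ 2 / w) := by ring
    _ ≤ 10 * (n ^ 2 / (Real.log n / 3)) := by gcongr; linarith
    _ = 30 * (n ^ 2 / Real.log n) := by field_simp; norm_num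

end Linear

/-! ### Multiply controlled NOT gates with borrowed wires. -/

section MultiControlled

variable {n : ℕ}

/-- A V-shaped ladder: the outermost Toffoli gate, from `c (k + 2)` and `a k` to `a (k + 1)`, is
applied before and after the shorter ladder. The unknown value of `a k` enters twice and cancels;
only its change, the product of the first controls, remains. -/
theorem exists_ladder (c a : ℕ → Fin n) (k : ℕ) (hc : Set.InjOn c (Set.Iio (k + 2)))
    (ha : Set.InjOn a (Set.Iio (k + 1))) (hca : ∀ i < k + 2, ∀ j < k + 1, c i ≠ a j) :
    ∃ σ, Words (toffolis n) (2 * k + 1) σ ∧ ∀ x, σ x = fun w => x w +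
      ∑ i ∈ Finset.range (k + 1), if w = a i then ∏ l ∈ Finset.range (i + 2), x (c l) else 0 := by
  induction k with
  | zero =>
    obtain ⟨σ, hσ, h⟩ := exists_toffoli (hca 0 (by omega) 0 (by omega))
      (hca 1 (by omega) 0 (by omega)) (fun h => absurd (hc (by simp) (by simp) h) (by omega))
    exact ⟨σ, .of_mem (Or.inr hσ), fun x => by
      rw [h]; ext w; simp [Finset.prod_range_succ]⟩
  | succ k ih =>
    obtain ⟨σ, hσ, h⟩ := ih (hc.mono fun i hi => Set.mem_Iio.2 (by have := Set.mem_Iio.1 hi; omega))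
      (ha.mono fun i hi => Set.mem_Iio.2 (by have := Set.mem_Iio.1 hi; omega))
      fun i hi j hj => hca i (by omega) j (by omega)
    have haj : ∀ j < k + 1, a j ≠ a (k + 1) := fun j hj h => by
      have := ha (Set.mem_Iio.2 (by omega)) (Set.mem_Iio.2 (by omega)) h
      omega
    obtain ⟨τ, hτ, h'⟩ := exists_toffoli (hca (k + 2) (by omega) (k + 1) (by omega))
      (haj k (by omega)) (hca (k + 2) (by omega) k (by omega))
    refine ⟨τ * (σ * τ), ((Words.of_mem (Or.inr hτ)).mul (hσ.mul (.of_mem (Or.inr hτ)))).mono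
      (by omega), fun x => ?_⟩
    have hcx : ∀ l < k + 3, τ x (c l) = x (c l) := fun l hl => by
      rw [h']; simp [hca l (by omega) (k + 1) (by omega)]
    have hp : ∀ i < k + 1, ∏ l ∈ Finset.range (i + 2), τ x (c l) =
        ∏ l ∈ Finset.range (i + 2), x (c l) := fun i hi =>
      Finset.prod_congr rfl fun l hl => hcx l (by have := Finset.mem_range.1 hl; omega)
    have hστ : σ (τ x) = fun w => τ x w + ∑ i ∈ Finset.range (k + 1),
        if w = a i then ∏ l ∈ Finset.range (i + 2), x (c l) else 0 := by
      rw [h]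
      ext w
      congr 1
      refine Finset.sum_congr rfl fun i hi => ?_
      rw [hp i (Finset.mem_range.1 hi)]
    have hc2 : σ (τ x) (c (k + 2)) = x (c (k + 2)) := by
      rw [hστ]
      simp only
      rw [hcx _ (by omega), Finset.sum_eq_zero, add_zero]
      intro i hi
      rw [if_neg (hca _ (by omega) _ (by have := Finset.mem_range.1 hi; omega))]
    have hak : σ (τ x) (a k) = x (a k) + ∏ l ∈ Finset.range (k + 2), x (c l) := by
      rw [hστ]
      simp only
      rw [Finset.sum_eq_single k]
      · rw [if_pos rfl, h']; simp [haj k (by omega)]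
      · intro i hi hik
        rw [if_neg]
        intro h
        exact hik (ha (Set.mem_Iio.2 (by omega))
          (Set.mem_Iio.2 (by have := Finset.mem_range.1 hi; omega)) h).symm
      · intro h; simp at h
    rw [Equiv.Perm.mul_apply, Equiv.Perm.mul_apply, h' (σ (τ x)), hc2, hak, hστ, h']
    ext w
    rw [Finset.sum_range_succ _ (k + 1), Finset.prod_range_succ _ (k + 2)]
    by_cases hw : w = a (k + 1)
    · subst hw
      have hz : (∑ i ∈ Finset.range (k + 1), if a (k + 1) = a i then
          ∏ l ∈ Finset.range (i + 2), x (c l) else 0) = 0 :=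
        Finset.sum_eq_zero fun i hi => if_neg (haj i (Finset.mem_range.1 hi)).symm
      simp only [if_true, hz]
      linear_combination (x (c (k + 2)) * x (a k)) * (CharTwo.two_eq_zero (R := ZMod 2))
    · simp [hw]

theorem exists_enumeration {α : Type*} [DecidableEq α] (s : Finset α) (z : α) :
    ∃ c : ℕ → α, Set.InjOn c (Set.Iio s.card) ∧ (Finset.range s.card).image c = s ∧
      (∀ i < s.card, c i ∈ s) ∧ ∀ i, s.card ≤ i → c i = z := by
  let c : ℕ → α := fun i => if h : i < s.card then (s.equivFin.symm ⟨i, h⟩ : α) else z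
  have hmem : ∀ i < s.card, c i ∈ s := fun i hi => by simp [c, hi]
  have hinj : Set.InjOn c (Set.Iio s.card) := by
    intro i hi j hj h
    rw [Set.mem_Iio] at hi hj
    simp only [c, hi, hj, dif_pos] at h
    simpa using s.equivFin.symm.injective (Subtype.ext h)
  refine ⟨c, hinj, ?_, hmem, fun i hi => by simp [c, hi.not_gt]⟩
  refine Finset.eq_of_subset_of_card_le ?_ ?_
  · intro x hx
    obtain ⟨i, hi, rfl⟩ := Finset.mem_image.1 hx
    exact hmem i (Finset.mem_range.1 hi)
  · rw [Finset.card_image_of_injOn (by simpa using hinj), Finset.card_range]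

theorem perm_eq_mcNot_one {ctrl : Finset (Fin n)} {t : Fin n} (ht : t ∉ ctrl)
    {σ : Equiv.Perm (Bits n)}
    (h : ∀ x, σ x = fun i => x i + if i = t then ∏ j ∈ ctrl, x j else 0) :
    σ = mcNot ctrl (fun _ => 1) t ht :=
  Equiv.ext fun x => by rw [h, mcNot_one_apply]

theorem mcNot_one_mem_simples (ctrl : Finset (Fin n)) (t : Fin n) (ht : t ∉ ctrl)
    (h : ctrl.card ≤ 2) : mcNot ctrl (fun _ => 1) t ht ∈ simples n := by
  interval_cases hc : ctrl.card
  · rw [Finset.card_eq_zero] at hc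
    subst hc
    exact Or.inl ⟨t, isMCNot_mcNot ..⟩
  · obtain ⟨c, rfl⟩ := Finset.card_eq_one.1 hc
    exact Or.inr (Or.inl ⟨c, t, isMCNot_mcNot ..⟩)
  · obtain ⟨c, c', hcc, rfl⟩ := Finset.card_eq_two.1 hc
    exact Or.inr (Or.inr ⟨c, c', t, hcc, isMCNot_mcNot ..⟩)

/-- A multiply controlled NOT, with auxiliary wires `D` in an arbitrary state. -/
theorem words_mcNot_one (ctrl D : Finset (Fin n)) (t : Fin n) (ht : t ∉ ctrl)
    (hD : Disjoint ctrl D) (htD : t ∉ D) (hcard : ctrl.card ≤ D.card + 2) :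
    Words (simples n) (4 * ctrl.card + 1) (mcNot ctrl (fun _ => 1) t ht) := by
  by_cases h2 : ctrl.card ≤ 2
  · exact (Words.of_mem (mcNot_one_mem_simples ctrl t ht h2)).mono (by omega)
  obtain ⟨k, hk⟩ : ∃ k, ctrl.card = k + 3 := ⟨ctrl.card - 3, by omega⟩
  obtain ⟨D', hD'D, hD'⟩ := Finset.exists_subset_card_eq (show k + 1 ≤ D.card by omega)
  obtain ⟨c, hci, hcimg, hcm, -⟩ := exists_enumeration ctrl t
  obtain ⟨a, hai, -, ham, hat⟩ := exists_enumeration D' t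
  rw [hk] at hci hcm hcimg
  rw [hD'] at hai ham hat
  -- The default value of the enumeration puts the target right after the `k + 1` borrowed wires, as
  -- the last rung of the longer ladder.
  have hat' : a (k + 1) = t := hat _ le_rfl
  have hane : ∀ i < k + 1, a i ≠ t := fun i hi h => htD (hD'D (h ▸ ham i hi))
  have ha : Set.InjOn a (Set.Iio (k + 1 + 1)) := by
    intro i hi j hj h
    rw [Set.mem_Iio] at hi hj
    by_cases hi' : i < k + 1
    · by_cases hj' : j < k + 1
      · exact hai hi' hj' h
      · obtain rfl : j = k + 1 := by omega
        rw [hat'] at h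
        exact absurd h (hane i hi')
    · obtain rfl : i = k + 1 := by omega
      by_cases hj' : j < k + 1
      · rw [hat'] at h
        exact absurd h.symm (hane j hj')
      · omega
  have hca : ∀ i < k + 3, ∀ j < k + 2, c i ≠ a j := by
    intro i hi j hj h
    by_cases hj' : j < k + 1
    · exact Finset.disjoint_left.1 hD (hcm i hi) (h ▸ hD'D (ham j hj'))
    · obtain rfl : j = k + 1 := by omega
      rw [hat'] at h
      exact ht (h ▸ hcm i hi)
  obtain ⟨σ, hσ, h⟩ := exists_ladder c a (k + 1) hci ha hca
  obtain ⟨τ, hτ, h'⟩ := exists_ladder c a k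
    (hci.mono fun i hi => Set.mem_Iio.2 (by have := Set.mem_Iio.1 hi; omega)) hai
    fun i hi j hj => hca i (by omega) j (by omega)
  -- The longer ladder also disturbs the borrowed wires, by exactly what the shorter one adds to
  -- them; only the target keeps its change.
  have hmul : σ * τ = mcNot ctrl (fun _ => 1) t ht := by
    refine perm_eq_mcNot_one ht fun x => ?_
    have hτc : ∀ l < k + 3, τ x (c l) = x (c l) := by
      intro l hl
      rw [h']
      simp only
      rw [Finset.sum_eq_zero, add_zero]
      intro i hi
      rw [if_neg (hca l hl i (by have := Finset.mem_range.1 hi; omega))]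
    have hprod : ∀ i < k + 2, ∏ l ∈ Finset.range (i + 2), τ x (c l) =
        ∏ l ∈ Finset.range (i + 2), x (c l) := fun i hi =>
      Finset.prod_congr rfl fun l hl => hτc l (by have := Finset.mem_range.1 hl; omega)
    rw [Equiv.Perm.mul_apply, h]
    ext w
    rw [Finset.sum_congr rfl fun i hi => by rw [hprod i (Finset.mem_range.1 hi)],
      Finset.sum_range_succ _ (k + 1), h', hat']
    have hctrl : ∏ j ∈ ctrl, x j = ∏ l ∈ Finset.range (k + 1 + 2), x (c l) := by
      conv_lhs => rw [← hcimg]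
      rw [Finset.prod_image]
      intro i hi j hj hij
      exact hci (by simpa using hi) (by simpa using hj) hij
    rw [hctrl, add_assoc, ← add_assoc (Finset.sum _ _), CharTwo.add_self_eq_zero, zero_add]
  rw [← hmul]
  exact ((hσ.mul hτ).mono_set toffolis_subset).mono (by omega)

theorem exists_nots (F : Finset (Fin n)) : ∃ σ, Words (simples n) F.card σ ∧
    ∀ x, σ x = fun i => x i + if i ∈ F then 1 else 0 := by
  induction F using Finset.induction_on with
  | empty => exact ⟨1, Words.one, fun x => by simp⟩
  | insert t F ht ih =>
    obtain ⟨σ, hσ, h⟩ := ih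
    refine ⟨mcNot ∅ (fun _ => 1) t (by simp) * σ,
      ((Words.of_mem (mcNot_one_mem_simples ∅ t _ (by simp))).mul hσ).mono
      (by rw [Finset.card_insert_of_notMem ht]; omega), fun x => ?_⟩
    rw [Equiv.Perm.mul_apply, mcNot_one_apply, h]
    ext i
    by_cases hi : i = t
    · subst hi; simp [ht]
    · simp [hi]

theorem mcNot_eq_conj {ctrl : Finset (Fin n)} {t : Fin n} (ht : t ∉ ctrl) (pat : Bits n)
    {ν : Equiv.Perm (Bits n)} (F : Finset (Fin n))
    (hF : ∀ j ∈ ctrl, (if j ∈ F then 1 else 0) = pat j + 1)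
    (h : ∀ x, ν x = fun i => x i + if i ∈ F then 1 else 0) :
    mcNot ctrl pat t ht = ν * (mcNot ctrl (fun _ => 1) t ht * ν) := by
  ext1 x
  have hx : (∀ j ∈ ctrl, ν x j = 1) ↔ ∀ j ∈ ctrl, x j = pat j := by
    refine forall₂_congr fun j hj => ?_
    rw [h]
    simp only [hF j hj]
    generalize x j = u
    generalize pat j = v
    revert u v; decide
  rw [Equiv.Perm.mul_apply, Equiv.Perm.mul_apply]
  change (if _ then _ else _) = ν (if ∀ j ∈ ctrl, ν x j = 1 then _ else _)
  simp only [hx]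
  have hνν : ν (ν x) = x := by
    rw [h (ν x), h]; ext i; simp [add_assoc, CharTwo.add_self_eq_zero]
  by_cases hc : ∀ j ∈ ctrl, x j = pat j
  · rw [if_pos hc, if_pos hc, h]
    ext i
    by_cases hi : i = t
    · subst hi
      simp only [Function.update_self, h]
      linear_combination -(if i ∈ F then (1 : ZMod 2) else 0) * (CharTwo.two_eq_zero (R := ZMod 2))
    · simp only [Function.update_of_ne hi]
      conv_lhs => rw [← hνν, h]
  · rw [if_neg hc, if_neg hc, hνν]

/-- A multiply controlled NOT, with one auxiliary wire `d` in an arbitrary state. -/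
theorem words_mcNot (ctrl : Finset (Fin n)) (pat : Bits n) (t d : Fin n) (ht : t ∉ ctrl)
    (hd : d ∉ ctrl) (hdt : d ≠ t) :
    Words (simples n) (18 * n + 4) (mcNot ctrl pat t ht) := by
  have hcard : ∀ F : Finset (Fin n), F.card ≤ n := fun F => by
    simpa using Finset.card_le_univ F
  -- The controls are halved so that each half provides the borrowed wires for the gate controlled
  -- by the other half.
  obtain ⟨F₁, hF₁, hc₁⟩ := Finset.exists_subset_card_eq (Nat.div_le_self ctrl.card 2)
  set F₂ := ctrl \ F₁ with hF₂
  have hc₂ : F₂.card = ctrl.card - ctrl.card / 2 := by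
    rw [hF₂, Finset.card_sdiff_of_subset hF₁, hc₁]
  have hdF₁ : d ∉ F₁ := fun h => hd (hF₁ h)
  have htF₁ : t ∉ F₁ := fun h => ht (hF₁ h)
  have hdF₂ : d ∉ F₂ := fun h => hd (Finset.sdiff_subset h)
  have htF₂ : t ∉ F₂ := fun h => ht (Finset.sdiff_subset h)
  have hdisj : Disjoint F₁ F₂ := Finset.disjoint_sdiff
  have ht₂ : t ∉ insert d F₂ := by simp [hdt.symm, htF₂]
  have w₁ := words_mcNot_one F₁ F₂ d hdF₁ hdisj hdF₂ (by omega)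
  have w₂ := words_mcNot_one (insert d F₂) F₁ t ht₂
    (Finset.disjoint_insert_left.2 ⟨hdF₁, hdisj.symm⟩) htF₁
    (by rw [Finset.card_insert_of_notMem hdF₂]; omega)
  set C₁ := mcNot F₁ (fun _ => 1) d hdF₁
  set C₂ := mcNot (insert d F₂) (fun _ => 1) t ht₂
  -- A commutator: `t` receives `∏ F₂` times the value of `d` before and after `∏ F₁` is added to
  -- it. The two contributions sum to the product over all controls, and `d` is restored.
  have key : C₂ * (C₁ * (C₂ * C₁)) = mcNot ctrl (fun _ => 1) t ht := by
    refine perm_eq_mcNot_one ht fun x => ?_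
    have n₁ : ∀ j ∈ F₁, j ≠ d ∧ j ≠ t := fun j hj =>
      ⟨ne_of_mem_of_not_mem hj hdF₁, ne_of_mem_of_not_mem hj htF₁⟩
    have n₂ : ∀ j ∈ F₂, j ≠ d ∧ j ≠ t := fun j hj =>
      ⟨ne_of_mem_of_not_mem hj hdF₂, ne_of_mem_of_not_mem hj htF₂⟩
    have e₁ : ∀ y : Bits n, (∀ j, j ≠ d ∧ j ≠ t → y j = x j) →
        C₁ y = fun i => y i + if i = d then ∏ j ∈ F₁, x j else 0 := fun y hy => by
      simp only [C₁]
      rw [mcNot_one_apply, Finset.prod_congr rfl fun j hj => hy j (n₁ j hj)]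
    have e₂ : ∀ y : Bits n, (∀ j, j ≠ d ∧ j ≠ t → y j = x j) →
        C₂ y = fun i => y i + if i = t then y d * ∏ j ∈ F₂, x j else 0 := fun y hy => by
      simp only [C₂]
      rw [mcNot_one_apply, Finset.prod_insert hdF₂,
        Finset.prod_congr rfl fun j hj => hy j (n₂ j hj)]
    have o₁ : ∀ y, ∀ j ≠ d, C₁ y j = y j := fun y j hj => by simp [C₁, mcNot_one_apply, hj]
    have o₂ : ∀ y, ∀ j ≠ t, C₂ y j = y j := fun y j hj => by simp [C₂, mcNot_one_apply, hj]
    simp only [Equiv.Perm.mul_apply]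
    rw [e₁ x fun _ _ => rfl, e₂, e₁, e₂, ← Finset.prod_sdiff hF₁, ← hF₂]
    · ext i
      by_cases hi : i = t
      · subst hi
        simp only [if_true, if_neg hdt, if_neg hdt.symm]
        linear_combination (x d * ∏ j ∈ F₂, x j + (∏ j ∈ F₁, x j) * ∏ j ∈ F₂, x j) *
          (CharTwo.two_eq_zero (R := ZMod 2))
      · by_cases hid : i = d
        · subst hid
          simp [hdt, add_assoc, CharTwo.add_self_eq_zero]
        · simp [hi, hid]
    all_goals
      intro j hj
      first
        | simp [hj.1]
        | simp [o₁ _ _ hj.1, o₂ _ _ hj.2, hj.1]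
  obtain ⟨ν, hν, h⟩ := exists_nots (ctrl.filter fun j => pat j = 0)
  rw [mcNot_eq_conj ht pat (ctrl.filter fun j => pat j = 0) (fun j hj => by
    rcases zmod_two_eq_zero_or_one (pat j) with h0 | h0 <;> simp [hj, h0, CharTwo.add_self_eq_zero]) h,
    ← key]
  -- Each of the four gates costs at most `4 * n + 1`, and each of the two layers of NOT gates at
  -- most `n`.
  refine (hν.mul ((w₂.mul (w₁.mul (w₂.mul w₁))).mul hν)).mono ?_
  have h1 := hcard (ctrl.filter fun j => pat j = 0)
  have h2 := hcard F₁
  have h3 := hcard (insert d F₂)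
  omega

end MultiControlled

/-! ### Conversion between one-hot and binary addresses. -/

section UnaryToBinary

variable {n : ℕ}

/-- The unit vector at `v` on the first `n - m` wires, and the `m`-bit binary expansion of `j` on
the others. -/
def hotBits (n m v j : ℕ) : Bits n := fun q =>
  if q.val < n - m then (if q.val = v then 1 else 0)
  else (if j.testBit (n - 1 - q.val) then 1 else 0)

/-- A conditional move of the hot bit from wire `p` to wire `p + 2 ^ i`: a Toffoli gate copies it,
and a CNOT gate back from the destination erases the original. The condition on `v` says that the
destination starts at `0`. -/
theorem exists_demuxGate {m i p : ℕ} (hi : i < m) (hp : p + 2 ^ i < n - m) :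
    ∃ σ, Words (toffolis n) 2 σ ∧ ∀ v j, v ≠ p + 2 ^ i →
      σ (hotBits n m v j) = hotBits n m (if v = p ∧ j.testBit i then p + 2 ^ i else v) j := by
  have h2 : 0 < 2 ^ i := by positivity
  let P : Fin n := ⟨p, by omega⟩
  let R : Fin n := ⟨p + 2 ^ i, by omega⟩
  let B : Fin n := ⟨n - 1 - i, by omega⟩
  have hPR : P ≠ R := by simp only [P, R, ne_eq, Fin.mk.injEq]; omega
  have hBR : B ≠ R := by simp only [B, R, ne_eq, Fin.mk.injEq]; omega
  have hPB : P ≠ B := by simp only [P, B, ne_eq, Fin.mk.injEq]; omega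
  obtain ⟨σ, hσ, h⟩ := exists_toffoli hPR hBR hPB
  obtain ⟨τ, hτ, h'⟩ := exists_cnot hPR.symm
  refine ⟨τ * σ, (Words.of_mem (cnots_subset hτ)).mul (.of_mem (Or.inr hσ)), fun v j hv => ?_⟩
  have eP : ∀ u, hotBits n m u j P = if p = u then 1 else 0 := fun u => by
    simp only [hotBits, P]; rw [if_pos (by omega)]
  have eR : ∀ u, hotBits n m u j R = if p + 2 ^ i = u then 1 else 0 := fun u => by
    simp only [hotBits, R]; rw [if_pos (by omega)]
  have eB : ∀ u, hotBits n m u j B = if j.testBit i then 1 else 0 := fun u => by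
    simp only [hotBits, B]; rw [if_neg (by omega)]
    rw [show n - 1 - (n - 1 - i) = i by omega]
  rw [Equiv.Perm.mul_apply, h, h']
  ext q
  simp only [eP, eR, eB, if_true]
  by_cases hq : q.val < n - m
  · by_cases hqP : q = P
    · subst hqP
      rw [eP, eP]
      by_cases hvp : v = p
      · subst hvp
        cases j.testBit i <;> simp [hPR, CharTwo.add_self_eq_zero]
      · simp [hPR, hvp, Ne.symm hvp, Ne.symm hv]
    · by_cases hqR : q = R
      · subst hqR
        rw [eR, eR]
        by_cases hvp : v = p
        · subst hvp
          cases j.testBit i <;> simp [hPR.symm]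
        · simp [hPR.symm, hvp, Ne.symm hvp]
      · have h1 : q.val ≠ p := fun h => hqP (Fin.ext h)
        have h3 : q.val ≠ p + 2 ^ i := fun h => hqR (Fin.ext h)
        simp only [hqP, hqR, if_false, add_zero, hotBits, hq, if_true]
        split_ifs <;> simp_all
  · have hqP : q ≠ P := fun h => hq (by rw [h]; simp only [P]; omega)
    have hqR : q ≠ R := fun h => hq (by rw [h]; simp only [R]; omega)
    simp [hqP, hqR, hotBits, hq]

/-- One level of a binary tree: the hot bit, at the position given by the low `i` bits of `j`, moves
by `2 ^ i` if bit `i` is set. Sources lie below `2 ^ i` and destinations do not, so a moved bit is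
not moved again. -/
theorem exists_demuxStage {m i : ℕ} (hi : i < m) (hm : 2 ^ m ≤ n - m) :
    ∃ σ, Words (toffolis n) (2 * 2 ^ i) σ ∧ ∀ j,
      σ (hotBits n m (j % 2 ^ i) j) = hotBits n m (j % 2 ^ (i + 1)) j := by
  have hpow : 2 ^ i + 2 ^ i ≤ 2 ^ m := by
    rw [← two_mul, ← pow_succ']; exact Nat.pow_le_pow_right (by norm_num) hi
  have key : ∀ r ≤ 2 ^ i, ∃ σ, Words (toffolis n) (2 * r) σ ∧ ∀ j,
      σ (hotBits n m (j % 2 ^ i) j) =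
        hotBits n m (if j % 2 ^ i < r ∧ j.testBit i then j % 2 ^ i + 2 ^ i else j % 2 ^ i) j := by
    intro r
    induction r with
    | zero => exact fun _ => ⟨1, Words.one, fun j => by simp⟩
    | succ r ih =>
      intro hr
      obtain ⟨σ, hσ, h⟩ := ih (by omega)
      obtain ⟨τ, hτ, h'⟩ := exists_demuxGate (n := n) (p := r) hi (by omega)
      refine ⟨τ * σ, (hτ.mul hσ).mono (by omega), fun j => ?_⟩
      have hj : j % 2 ^ i < 2 ^ i := Nat.mod_lt _ (by positivity)
      rw [Equiv.Perm.mul_apply, h, h']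
      · congr 1
        cases j.testBit i
        · simp
        · simp only [and_true]
          split_ifs <;> omega
      · split_ifs <;> omega
  obtain ⟨σ, hσ, h⟩ := key _ le_rfl
  refine ⟨σ, hσ, fun j => ?_⟩
  rw [h, Nat.mod_pow_succ]
  have hj : j % 2 ^ i < 2 ^ i := Nat.mod_lt _ (by positivity)
  rw [Nat.testBit_eq_decide_div_mod_eq]
  rcases Nat.mod_two_eq_zero_or_one (j / 2 ^ i) with h0 | h0 <;> simp [hj, h0]

theorem exists_demux {m : ℕ} (hm : 2 ^ m ≤ n - m) :
    ∃ σ, Words (toffolis n) (2 * 2 ^ m) σ ∧ ∀ j < 2 ^ m,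
      σ (swapBits n m j) = hotBits n m j j := by
  have key : ∀ r ≤ m, ∃ σ, Words (toffolis n) (2 * 2 ^ r) σ ∧ ∀ j,
      σ (swapBits n m j) = hotBits n m (j % 2 ^ r) j := by
    intro r
    induction r with
    | zero => exact fun _ => ⟨1, Words.one, fun j => by rw [pow_zero, Nat.mod_one]; rfl⟩
    | succ r ih =>
      intro hr
      obtain ⟨σ, hσ, h⟩ := ih (by omega)
      obtain ⟨τ, hτ, h'⟩ := exists_demuxStage (n := n) hr hm
      refine ⟨τ * σ, (hτ.mul hσ).mono (by rw [pow_succ]; omega), fun j => ?_⟩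
      rw [Equiv.Perm.mul_apply, h, h']
  obtain ⟨σ, hσ, h⟩ := key m le_rfl
  exact ⟨σ, hσ, fun j hj => by rw [h, Nat.mod_eq_of_lt hj]⟩

/-- The hot wire determines the address: fanning out wire `r` to the positions of the ones of `r`
erases the binary part when `j = r` and does nothing for other `j`. -/
theorem exists_clearBinary {m : ℕ} (hm : 2 ^ m ≤ n - m) :
    ∃ σ, Words (toffolis n) (2 ^ m * m) σ ∧ ∀ j < 2 ^ m,
      σ (hotBits n m j j) = unitBits n j := by
  have key : ∀ r ≤ 2 ^ m, ∃ σ, Words (toffolis n) (r * m) σ ∧ ∀ j < 2 ^ m,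
      σ (hotBits n m j j) = if j < r then unitBits n j else hotBits n m j j := by
    intro r
    induction r with
    | zero => exact fun _ => ⟨1, Words.one, fun j => by simp⟩
    | succ r ih =>
      intro hr
      obtain ⟨σ, hσ, h⟩ := ih (by omega)
      let F : Finset (Fin n) := Finset.univ.filter fun q =>
        ¬ q.val < n - m ∧ r.testBit (n - 1 - q.val)
      have hF : F.card ≤ m := by
        rw [← Finset.card_range m]
        refine Finset.card_le_card_of_injOn (fun q : Fin n => n - 1 - q.val) ?_ ?_
        · intro q hq
          have := (Finset.mem_filter.1 (Finset.mem_coe.1 hq)).2.1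
          have := q.2
          simp; omega
        · intro q _ q' _ hqq
          have := q.2
          have := q'.2
          simp only at hqq
          exact Fin.ext (by omega)
      let R : Fin n := ⟨r, by omega⟩
      obtain ⟨τ, hτ, h'⟩ := exists_fanOut R F (by simp [F, R]; omega)
      refine ⟨τ * σ, ((hτ.mono_set cnots_subset).mul hσ).mono (by rw [add_mul]; omega),
        fun j hj => ?_⟩
      rw [Equiv.Perm.mul_apply, h j hj]
      by_cases hjr : j < r
      · rw [if_pos hjr, if_pos (show j < r + 1 by omega), h']
        have : unitBits n j R = 0 := by simp only [unitBits, R]; rw [if_neg (by omega)]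
        ext q; simp [this]
      · rw [if_neg hjr, h']
        have e : hotBits n m j j R = if r = j then 1 else 0 := by
          simp only [hotBits, R]; rw [if_pos (by omega)]
        rw [e]
        by_cases hrj : r = j
        · subst hrj
          rw [if_pos (Nat.lt_succ_self r)]
          ext q
          by_cases hq : q.val < n - m
          · simp only [F, hotBits, unitBits, hq, Finset.mem_filter]; simp
          · have hqr : q.val ≠ r := by omega
            simp only [F, hotBits, unitBits, hq, hqr, if_false, Finset.mem_filter,
              Finset.mem_univ, true_and, not_false_iff]
            cases r.testBit (n - 1 - q.val) <;> simp [CharTwo.add_self_eq_zero]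
        · rw [if_neg (show ¬ j < r + 1 by omega)]
          ext q; simp [hrj]
  obtain ⟨σ, hσ, h⟩ := key _ le_rfl
  exact ⟨σ, hσ, fun j hj => by rw [h j hj, if_pos hj]⟩

/-- The map from unit vectors to binary expansions. -/
theorem exists_unaryToBinary {m : ℕ} (hm : 2 ^ m ≤ n - m) :
    ∃ M, Words (toffolis n) (2 ^ m * (m + 2)) M ∧ ∀ j < 2 ^ m,
      M (unitBits n j) = swapBits n m j := by
  obtain ⟨σ, hσ, h⟩ := exists_demux (n := n) hm
  obtain ⟨τ, hτ, h'⟩ := exists_clearBinary (n := n) hm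
  -- The circuit is built from binary to one-hot, where the work wires start at known values, and
  -- then inverted.
  refine ⟨(τ * σ)⁻¹, ((hτ.mul hσ).mono (by rw [mul_add]; omega)).inv inv_mem_toffolis,
    fun j hj => ?_⟩
  rw [Equiv.Perm.inv_eq_iff_eq, Equiv.Perm.mul_apply, h j hj, h' j hj]

end UnaryToBinary

/-! ### Mapping the chosen pairs to unit vectors. -/

section PairMap

variable {n : ℕ}

theorem isLinearRev_toEquiv (r : Bits n ≃ₗ[ZMod 2] Bits n) : IsLinearRev r.toEquiv :=
  fun x y => r.map_add x y

theorem exists_linearEquiv_apply_eq {K V ι : Type*} [Field K] [AddCommGroup V] [Module K V]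
    [FiniteDimensional K V] {v w : ι → V} (hv : LinearIndependent K v)
    (hw : LinearIndependent K w) : ∃ r : V ≃ₗ[K] V, ∀ i, r (v i) = w i := by
  obtain ⟨r, hr⟩ := Submodule.exists_linearEquiv_restrict_eq
    ((Module.Basis.span hv).equiv (Module.Basis.span hw) (Equiv.refl ι))
  refine ⟨r, fun i => ?_⟩
  have h := hr (Module.Basis.span hv i)
  rw [Module.Basis.equiv_apply, Module.Basis.span_apply, Module.Basis.span_apply] at h
  exact h.symm

theorem unitBits_val (c : Fin n) : unitBits n c.val = stdVec c := by
  ext q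
  simp [unitBits, Pi.single_apply, Fin.ext_iff]

theorem linearIndependent_stdVec {ι : Type*} {f : ι → Fin n} (hf : Function.Injective f) :
    LinearIndependent (ZMod 2) fun i => (stdVec (f i) : Bits n) := by
  have := (Pi.basisFun (ZMod 2) (Fin n)).linearIndependent.comp f hf
  convert this using 1
  ext i : 1
  simp

theorem exists_linearRev_of_triangular (c : Fin n → Bits n) (h1 : ∀ q, c q q = 1)
    (h0 : ∀ q j, q < j → c q j = 0) :
    ∃ R : Equiv.Perm (Bits n), IsLinearRev R ∧ ∀ q, R (stdVec q) = c q := by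
  let M : Matrix (Fin n) (Fin n) (ZMod 2) := Matrix.of fun i q => c q i
  have hdet : M.det = 1 := by
    rw [Matrix.det_of_isUpperTriangular (M := M) fun i j hij => h0 j i hij]
    exact Finset.prod_eq_one fun i _ => h1 i
  have hu : IsUnit M.det := by rw [hdet]; exact isUnit_one
  have hinv : Invertible M := M.invertibleOfIsUnitDet hu
  refine ⟨(Matrix.toLinearEquiv' M hinv).toEquiv, isLinearRev_toEquiv _, fun q => ?_⟩
  change M.mulVec (Pi.single q 1) = _
  rw [Matrix.mulVec_single_one]
  rfl

/-- Here `y t` is the partner of the unit vector at `2 * t`. A bad partner looks like that unit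
vector from position `2 * t` on. One Toffoli gate with target `2 * t + 1` makes it look like the
unit vector at `2 * t + 1` from there on, which is the triangular shape that a linear map can
straighten. Earlier partners have a `0` at the control `2 * t`, and for later ones the target lies
below the positions that matter. -/
theorem exists_separatingToffolis {k : ℕ} (hkn : 2 * k ≤ n) (y : Fin k → Bits n)
    (hy : ∀ t, y t ≠ unitBits n (2 * t.val))
    (hy' : ∀ t, y t = unitBits n (2 * t.val + 1) ∨
      ∀ q : Fin n, 2 * t.val ≤ q.val → y t q = unitBits n (2 * t.val) q)
    (s : ℕ) (hs : s ≤ k) :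
    ∃ w : List (Equiv.Perm (Bits n)), (∀ g ∈ w, IsToffoli g) ∧ w.length ≤ s - 1 ∧
      (∀ t : Fin k, w.prod (unitBits n (2 * t.val)) = unitBits n (2 * t.val)) ∧
      (∀ t : Fin k, t.val < s → ∀ q : Fin n, 2 * t.val + 1 ≤ q.val →
        w.prod (y t) q = unitBits n (2 * t.val + 1) q) ∧
      (∀ t : Fin k, s ≤ t.val → w.prod (y t) = unitBits n (2 * t.val + 1) ∨
        ∀ q : Fin n, 2 * t.val ≤ q.val → w.prod (y t) q = unitBits n (2 * t.val) q) := by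
  induction s with
  | zero => exact ⟨[], by simp, by simp, by simp, by simp, by simpa using hy'⟩
  | succ s ih =>
    obtain ⟨w, hw, hlen, ha, hlt, hge⟩ := ih (by omega)
    let t₀ : Fin k := ⟨s, hs⟩
    rcases hge t₀ le_rfl with h | h
    · refine ⟨w, hw, by omega, ha, fun t ht q hq => ?_, fun t ht => hge t (by omega)⟩
      rcases Nat.lt_succ_iff_lt_or_eq.1 ht with ht | ht
      · exact hlt t ht q hq
      · obtain rfl : t = t₀ := Fin.ext ht
        rw [h]
    · obtain ⟨p, hp, hp1⟩ : ∃ p : Fin n, p.val < 2 * s ∧ w.prod (y t₀) p = 1 := by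
        by_contra! hcon
        refine hy t₀ (w.prod.injective ?_)
        rw [ha]
        ext q
        by_cases hq : 2 * s ≤ q.val
        · exact h q hq
        · rw [(zmod_two_eq_zero_or_one _).resolve_right (hcon q (by omega)), unitBits,
            if_neg (by simp only [t₀]; omega)]
      let A : Fin n := ⟨2 * s, by omega⟩
      let B : Fin n := ⟨2 * s + 1, by omega⟩
      obtain ⟨g, hg, hgx⟩ := exists_toffoli (c := A) (c' := p) (t := B)
        (by simp [A, B]) (fun h => by rw [h] at hp; simp only [B] at hp; omega)
        (fun h => by rw [← h] at hp; simp only [A] at hp; omega)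
      -- The two controls are distinct, and a unit vector sets at most one of them.
      have hunit : ∀ j, g (unitBits n j) = unitBits n j := by
        intro j
        have : unitBits n j A * unitBits n j p = 0 := by
          simp only [unitBits, A]
          by_cases hj : p.val = j
          · rw [if_neg (by omega), zero_mul]
          · rw [if_neg hj, mul_zero]
        rw [hgx, this]
        ext; simp
      refine ⟨g :: w, by simpa using ⟨hg, hw⟩, by simp; omega, fun t => ?_, ?_, ?_⟩
      · rw [List.prod_cons, Equiv.Perm.mul_apply, ha, hunit]
      · intro t ht q hq
        rw [List.prod_cons, Equiv.Perm.mul_apply, hgx]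
        rcases Nat.lt_succ_iff_lt_or_eq.1 ht with ht | ht
        · have : w.prod (y t) A = 0 := by
            rw [hlt t ht A (by simp only [A]; omega), unitBits, if_neg (by simp only [A]; omega)]
          rw [this]
          simp [hlt t ht q hq]
        · obtain rfl : t = t₀ := Fin.ext ht
          rw [hp1, h A le_rfl]
          simp only [t₀, A, B, unitBits, Fin.ext_iff] at hq h ⊢
          rw [h q (by omega), if_neg (by omega)]
          simp
      · intro t ht
        rw [List.prod_cons, Equiv.Perm.mul_apply]
        rcases hge t (by omega) with h' | h'
        · exact Or.inl (by rw [h', hunit])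
        · refine Or.inr fun q hq => ?_
          rw [hgx]
          have : q ≠ B := by
            rintro rfl; simp only [B] at hq; omega
          simp [this, h' q hq]

theorem apply_eq_zero_of_mem_span {V : Set (Bits n)} {q : Fin n} (h : ∀ v ∈ V, v q = 0)
    {x : Bits n} (hx : x ∈ Submodule.span (ZMod 2) V) : x q = 0 := by
  have : Submodule.span (ZMod 2) V ≤ LinearMap.ker (LinearMap.proj q : Bits n →ₗ[ZMod 2] ZMod 2) :=
    Submodule.span_le.2 fun v hv => h v hv
  exact this hx

/-- The reversible map that sends pairs to unit vectors. -/
theorem exists_pairMap {k : ℕ} (hk : 0 < k) (hkn : 2 * k ≤ n) (a b z : Fin k → Bits n)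
    (hlin : LinearIndependent (ZMod 2) (Sum.elim a z)) (hab : ∀ t, b t ≠ a t)
    (hb : ∀ t, b t = z t ∨
      a t + b t ∈ Submodule.span (ZMod 2) (a '' Set.Iio t ∪ z '' Set.Iio t)) :
    ∃ (R₁ R₂ : Equiv.Perm (Bits n)) (w : List (Equiv.Perm (Bits n))),
      IsLinearRev R₁ ∧ IsLinearRev R₂ ∧ (∀ g ∈ w, IsToffoli g) ∧ w.length < k ∧
      ∀ t, (R₂ * w.prod * R₁) (a t) = unitBits n (2 * t.val) ∧
        (R₂ * w.prod * R₁) (b t) = unitBits n (2 * t.val + 1) := by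
  let A : Fin k → Fin n := fun t => ⟨2 * t.val, by omega⟩
  let B : Fin k → Fin n := fun t => ⟨2 * t.val + 1, by omega⟩
  have hf : Function.Injective (Sum.elim A B) := by
    rintro (t | t) (t' | t') h <;> simp [A, B] at h ⊢ <;> omega
  obtain ⟨r, hr⟩ := exists_linearEquiv_apply_eq hlin (linearIndependent_stdVec hf)
  have hra : ∀ t, r (a t) = unitBits n (2 * t.val) := fun t => by
    rw [← show (A t).val = 2 * t.val from rfl, unitBits_val]; exact hr (Sum.inl t)
  have hrz : ∀ t, r (z t) = unitBits n (2 * t.val + 1) := fun t => by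
    rw [← show (B t).val = 2 * t.val + 1 from rfl, unitBits_val]; exact hr (Sum.inr t)
  obtain ⟨w, hw, hlen, ha, hlt, -⟩ := exists_separatingToffolis hkn (fun t => r (b t))
    (fun t => by rw [← hra]; exact fun h => hab t (r.injective h))
    (fun t => by
      rcases hb t with h | h
      · exact Or.inl (by rw [h, hrz])
      · refine Or.inr fun q hq => ?_
        -- The image under `r` of the earlier span lives on positions below `2 * t`, so the images
        -- of `a t` and `b t` agree from `2 * t` on.
        have h1 := Submodule.mem_map_of_mem (f := r.toLinearMap) h
        rw [Submodule.map_span] at h1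
        have h2 := apply_eq_zero_of_mem_span (q := q) (fun v hv => by
          obtain ⟨u, hu, rfl⟩ := hv
          rcases hu with ⟨s, hs, rfl⟩ | ⟨s, hs, rfl⟩
          · have hs : s.val < t.val := hs
            change r (a s) q = 0
            rw [hra, unitBits, if_neg (by omega)]
          · have hs : s.val < t.val := hs
            change r (z s) q = 0
            rw [hrz, unitBits, if_neg (by omega)]) h1
        have h3 : r (a t) q + r (b t) q = 0 := by
          rw [← Pi.add_apply, ← map_add]; exact h2
        rw [← hra]
        exact (CharTwo.add_eq_zero.1 h3).symm) k le_rfl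
  -- Columns of a unitriangular matrix: the current images of the `b t` at odd positions below `2 *
  -- k`, unit vectors elsewhere. The second linear map is the inverse of this matrix.
  let c : Fin n → Bits n := fun q =>
    if h : q.val < 2 * k ∧ q.val % 2 = 1 then w.prod (r (b ⟨q.val / 2, by omega⟩)) else stdVec q
  have hcB : ∀ t, c (B t) = w.prod (r (b t)) := fun t => by
    have h1 : (B t).val < 2 * k ∧ (B t).val % 2 = 1 := by
      simp only [B]; omega
    have h2 : (⟨(B t).val / 2, by omega⟩ : Fin k) = t := Fin.ext (by simp only [B]; omega)
    simp only [c, dif_pos h1, h2]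
  have hcA : ∀ t, c (A t) = stdVec (A t) := fun t => by
    have h1 : ¬ ((A t).val < 2 * k ∧ (A t).val % 2 = 1) := by
      simp only [A]; omega
    simp only [c, dif_neg h1]
  have hc : ∀ q j, q ≤ j → c q j = (stdVec q : Bits n) j := by
    intro q j hqj
    by_cases h : q.val < 2 * k ∧ q.val % 2 = 1
    · obtain ⟨t, rfl⟩ : ∃ t, q = B t :=
        ⟨⟨q.val / 2, by omega⟩, Fin.ext (by simp only [B]; omega)⟩
      rw [hcB, hlt t t.2 j hqj, ← unitBits_val]
    · simp only [c, dif_neg h]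
  obtain ⟨R, hR, hRc⟩ := exists_linearRev_of_triangular c
    (fun q => by rw [hc q q le_rfl]; simp)
    (fun q j hqj => by rw [hc q j hqj.le]; simp [hqj.ne'])
  refine ⟨r.toEquiv, R⁻¹, w, isLinearRev_toEquiv r, ?_, hw, by omega, fun t => ⟨?_, ?_⟩⟩
  · intro x y
    rw [Equiv.Perm.inv_eq_iff_eq, hR]; simp
  · simp only [Equiv.Perm.mul_apply]
    rw [Equiv.Perm.inv_eq_iff_eq, ← show (A t).val = 2 * t.val from rfl, unitBits_val, hRc, hcA]
    change w.prod (r (a t)) = _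
    rw [hra, ha, ← unitBits_val]
  · simp only [Equiv.Perm.mul_apply]
    rw [Equiv.Perm.inv_eq_iff_eq, ← show (B t).val = 2 * t.val + 1 from rfl, unitBits_val, hRc,
      hcB]
    rfl

end PairMap

/-! ### Greedy choice of independent pairs. -/

section Selection

variable {n : ℕ}

theorem Bits.add_self (x : Bits n) : x + x = 0 :=
  funext fun i => CharTwo.add_self_eq_zero (x i)

/-- The condition on the entries `2 * t` and `2 * t + 1` of a sequence listing chosen pairs. -/
structure IsPairAt (P : Equiv.Perm (Bits n)) (v : ℕ → Bits n) (t : ℕ) : Prop where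
  moved : P (v (2 * t)) ≠ v (2 * t)
  left_notMem : v (2 * t) ∉ Submodule.span (ZMod 2) (v '' Set.Iio (2 * t))
  image_notMem : P (v (2 * t)) ∉ Submodule.span (ZMod 2) (v '' Set.Iio (2 * t))
  right_notMem : v (2 * t + 1) ∉ Submodule.span (ZMod 2) (v '' Set.Iio (2 * t + 1))
  image_eq : P (v (2 * t)) = v (2 * t + 1) ∨
    v (2 * t) + P (v (2 * t)) ∈ Submodule.span (ZMod 2) (v '' Set.Iio (2 * t))
  image_zero : t = 0 → v (2 * t + 1) = P (v (2 * t))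

theorem IsPairAt.congr {P : Equiv.Perm (Bits n)} {v v' : ℕ → Bits n} {t : ℕ}
    (h : IsPairAt P v t) (hv : ∀ j < 2 * t + 2, v' j = v j) : IsPairAt P v' t := by
  have e1 : v' '' Set.Iio (2 * t) = v '' Set.Iio (2 * t) :=
    Set.image_congr fun j hj => hv j (by have := Set.mem_Iio.1 hj; omega)
  have e2 : v' '' Set.Iio (2 * t + 1) = v '' Set.Iio (2 * t + 1) :=
    Set.image_congr fun j hj => hv j (by have := Set.mem_Iio.1 hj; omega)
  have e3 := hv (2 * t) (by omega)
  have e4 := hv (2 * t + 1) (by omega)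
  obtain ⟨h1, h2, h3, h4, h5, h6⟩ := h
  constructor <;> simpa only [e1, e2, e3, e4]

theorem finrank_span_image_Iio_le (v : ℕ → Bits n) (j : ℕ) :
    Module.finrank (ZMod 2) (Submodule.span (ZMod 2) (v '' Set.Iio j)) ≤ j := by
  have : v '' Set.Iio j = ((Finset.range j).image v : Finset (Bits n)) := by
    rw [Finset.coe_image, Finset.coe_range]
  rw [this]
  exact (finrank_span_finset_le_card _).trans (Finset.card_image_le.trans (by simp))

/-- `W` and its preimage under `P` together have at most `2 ^ (r + 1)` elements, so they cannot
cover the support. -/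
theorem exists_moved_notMem (P : Equiv.Perm (Bits n)) (W : Submodule (ZMod 2) (Bits n)) (r : ℕ)
    (hW : Module.finrank (ZMod 2) W ≤ r) (hP : 2 ^ (r + 1) < P.support.card) :
    ∃ a, P a ≠ a ∧ a ∉ W ∧ P a ∉ W := by
  classical
  let F : Finset (Bits n) := Finset.univ.filter (· ∈ W)
  have hF : F.card ≤ 2 ^ r := by
    have h1 : F.card = Nat.card W := by
      rw [Nat.card_eq_fintype_card]
      exact (Fintype.card_of_subtype F (by simp [F])).symm
    rw [h1, Module.natCard_eq_pow_finrank (K := ZMod 2), Nat.card_zmod]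
    exact Nat.pow_le_pow_right (by norm_num) hW
  have hc : (F ∪ F.image P.symm).card < P.support.card := by
    have h1 := Finset.card_union_le F (F.image P.symm)
    have h2 : (F.image P.symm).card ≤ F.card := Finset.card_image_le
    rw [pow_succ] at hP
    omega
  obtain ⟨a, ha, ha'⟩ := Finset.exists_mem_notMem_of_card_lt_card hc
  refine ⟨a, Equiv.Perm.mem_support.1 ha, fun h => ha' ?_, fun h => ha' ?_⟩
  · exact Finset.mem_union_left _ (by simpa [F] using h)
  · exact Finset.mem_union_right _ (Finset.mem_image.2 ⟨P a, by simpa [F] using h, by simp⟩)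

/-- The sequence `v` interleaves the `a t` (even indices) and the `z t` (odd indices), so that
independence becomes a condition on initial segments. -/
theorem exists_pairSequence (P : Equiv.Perm (Bits n)) {k : ℕ} (hkn : 2 * k ≤ n)
    (hP : 2 ^ (2 * k - 1) < P.support.card) (s : ℕ) (hs : s ≤ k) :
    ∃ v : ℕ → Bits n, ∀ t < s, IsPairAt P v t := by
  induction s with
  | zero => exact ⟨0, by simp⟩
  | succ s ih =>
    obtain ⟨v, hv⟩ := ih (by omega)
    set W := Submodule.span (ZMod 2) (v '' Set.Iio (2 * s)) with hW
    have hWr : Module.finrank (ZMod 2) W ≤ 2 * s := finrank_span_image_Iio_le v _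
    -- The exponent in the hypothesis on the support comes from the last pair: there `s = k - 1`,
    -- and `2 * s + 1 = 2 * k - 1`.
    obtain ⟨a, ha, haW, hPaW⟩ := exists_moved_notMem P W (2 * s) hWr
      ((Nat.pow_le_pow_right (by norm_num) (by omega)).trans_lt hP)
    obtain ⟨z, hz, hz', hz0⟩ : ∃ z, z ∉ Submodule.span (ZMod 2) (insert a (v '' Set.Iio (2 * s))) ∧
        (P a = z ∨ a + P a ∈ W) ∧ (s = 0 → z = P a) := by
      -- If `P a` depends on `a` and `W` but is not in `W`, then `a` occurs in it with coefficient
      -- `1`, so `a + P a ∈ W`, and `z` can be any new vector. For `s = 0` this would force `P a =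
      -- a`, so the first `z` is always `P a`.
      by_cases hmem : P a ∈ Submodule.span (ZMod 2) (insert a (v '' Set.Iio (2 * s)))
      · obtain ⟨c, u, hu, hcu⟩ := Submodule.mem_span_insert.1 hmem
        rw [← hW] at hu
        have haP : a + P a ∈ W := by
          rcases zmod_two_eq_zero_or_one c with rfl | rfl
          · rw [zero_smul, zero_add] at hcu
            exact absurd (hcu ▸ hu) hPaW
          · rw [hcu, one_smul, ← add_assoc, Bits.add_self, zero_add]
            exact hu
        have hs0 : s ≠ 0 := by
          rintro rfl
          have h0 : a + P a = 0 := by simpa [hW] using haP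
          refine ha ?_
          rw [← zero_add (P a), ← Bits.add_self a, add_assoc, h0, add_zero]
        obtain ⟨z, hz⟩ : ∃ z, z ∉ Submodule.span (ZMod 2) (insert a (v '' Set.Iio (2 * s))) := by
          by_contra! hall
          have h1 : Submodule.span (ZMod 2) (insert a (v '' Set.Iio (2 * s))) = ⊤ :=
            Submodule.eq_top_iff'.2 hall
          have h2 := finrank_span_image_Iio_le (Function.update v (2 * s) a) (2 * s + 1)
          have h3 : Function.update v (2 * s) a '' Set.Iio (2 * s + 1) =
              insert a (v '' Set.Iio (2 * s)) := by
            rw [← Order.succ_eq_add_one, Order.Iio_succ_eq_insert, Set.image_insert_eq,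
              Function.update_self]
            congr 1
            exact Set.image_congr fun j hj => Function.update_of_ne (Set.mem_Iio.1 hj).ne _ _
          rw [h3, h1, finrank_top, Module.finrank_fin_fun] at h2
          omega
        exact ⟨z, hz, Or.inr haP, fun h => absurd h hs0⟩
      · exact ⟨P a, hmem, Or.inl rfl, fun _ => rfl⟩
    set v' := Function.update (Function.update v (2 * s) a) (2 * s + 1) z with hv'
    have hold : ∀ j < 2 * s, v' j = v j := fun j hj => by
      rw [hv', Function.update_of_ne (by omega), Function.update_of_ne (by omega)]
    have hva : v' (2 * s) = a := by
      rw [hv', Function.update_of_ne (by omega), Function.update_self]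
    have hvz : v' (2 * s + 1) = z := Function.update_self ..
    have e1 : v' '' Set.Iio (2 * s) = v '' Set.Iio (2 * s) :=
      Set.image_congr fun j hj => hold j (Set.mem_Iio.1 hj)
    have e2 : v' '' Set.Iio (2 * s + 1) = insert a (v '' Set.Iio (2 * s)) := by
      rw [← Order.succ_eq_add_one, Order.Iio_succ_eq_insert, Set.image_insert_eq, hva, e1]
    refine ⟨v', fun t ht => ?_⟩
    rcases Nat.lt_succ_iff_lt_or_eq.1 ht with ht | rfl
    · exact (hv t ht).congr fun j hj => hold j (by omega)
    · constructor <;> simpa only [hva, hvz, e1, e2]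

theorem linearIndependent_of_notMem_span_Iio {K V : Type*} [Field K] [AddCommGroup V] [Module K V]
    (v : ℕ → V) (r : ℕ) (h : ∀ j < r, v j ∉ Submodule.span K (v '' Set.Iio j)) :
    LinearIndependent K fun i : Fin r => v i := by
  induction r with
  | zero => exact linearIndependent_empty_type
  | succ r ih =>
    rw [linearIndependent_finSucc']
    refine ⟨ih fun j hj => h j (by omega), ?_⟩
    have : Set.range (Fin.init fun i : Fin (r + 1) => v i) = v '' Set.Iio r := by
      ext x
      constructor
      · rintro ⟨i, rfl⟩
        exact ⟨i, i.2, rfl⟩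
      · rintro ⟨i, hi, rfl⟩
        exact ⟨⟨i, hi⟩, rfl⟩
    rw [this]
    exact h r (by omega)

theorem exists_pairs (P : Equiv.Perm (Bits n)) {k : ℕ} (hkn : 2 * k ≤ n)
    (hP : 2 ^ (2 * k - 1) < P.support.card) :
    ∃ a z : Fin k → Bits n, LinearIndependent (ZMod 2) (Sum.elim a z) ∧
      (∀ t, P (a t) ≠ a t) ∧ (∀ t, t.val = 0 → z t = P (a t)) ∧
      (∀ t, a t ∉ Submodule.span (ZMod 2) (a '' Set.Iio t ∪ z '' Set.Iio t) ∧
        P (a t) ∉ Submodule.span (ZMod 2) (a '' Set.Iio t ∪ z '' Set.Iio t)) ∧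
      ∀ t, P (a t) = z t ∨
        a t + P (a t) ∈ Submodule.span (ZMod 2) (a '' Set.Iio t ∪ z '' Set.Iio t) := by
  obtain ⟨v, hv⟩ := exists_pairSequence P hkn hP k le_rfl
  let a : Fin k → Bits n := fun t => v (2 * t.val)
  let z : Fin k → Bits n := fun t => v (2 * t.val + 1)
  have himg : ∀ t : Fin k, a '' Set.Iio t ∪ z '' Set.Iio t = v '' Set.Iio (2 * t.val) := by
    intro t
    ext x
    constructor
    · rintro (⟨s, hs, rfl⟩ | ⟨s, hs, rfl⟩)
      · have hs : s.val < t.val := hs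
        exact ⟨2 * s.val, Set.mem_Iio.2 (by omega), rfl⟩
      · have hs : s.val < t.val := hs
        exact ⟨2 * s.val + 1, Set.mem_Iio.2 (by omega), rfl⟩
    · rintro ⟨j, hj, rfl⟩
      rw [Set.mem_Iio] at hj
      have hlt : (⟨j / 2, by omega⟩ : Fin k) < t := Fin.lt_def.2 (by simp only; omega)
      rcases Nat.mod_two_eq_zero_or_one j with h | h
      · exact Or.inl ⟨⟨j / 2, by omega⟩, hlt, by
          simp only [a]; congr 1; omega⟩
      · exact Or.inr ⟨⟨j / 2, by omega⟩, hlt, by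
          simp only [z]; congr 1; omega⟩
  refine ⟨a, z, ?_, fun t => (hv t t.2).moved, fun t ht => (hv t t.2).image_zero ht, fun t => ?_,
    fun t => ?_⟩
  · have h1 := linearIndependent_of_notMem_span_Iio (K := ZMod 2) v (2 * k) fun j hj => by
      rcases Nat.mod_two_eq_zero_or_one j with h | h
      · have := (hv (j / 2) (by omega)).left_notMem
        rwa [show 2 * (j / 2) = j by omega] at this
      · have := (hv (j / 2) (by omega)).right_notMem
        rwa [show 2 * (j / 2) + 1 = j by omega] at this
    have hf : Function.Injective (Sum.elim (fun t : Fin k => (⟨2 * t.val, by omega⟩ : Fin (2 * k)))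
        (fun t : Fin k => (⟨2 * t.val + 1, by omega⟩ : Fin (2 * k)))) := by
      rintro (t | t) (t' | t') h <;> simp at h ⊢ <;> omega
    have h2 := h1.comp _ hf
    have h3 : Sum.elim a z = (fun i : Fin (2 * k) => v i) ∘
        Sum.elim (fun t : Fin k => (⟨2 * t.val, by omega⟩ : Fin (2 * k)))
          (fun t : Fin k => (⟨2 * t.val + 1, by omega⟩ : Fin (2 * k))) := by
      ext1 (t | t) <;> rfl
    rw [h3]
    exact h2
  · rw [himg]
    exact ⟨(hv t t.2).left_notMem, (hv t t.2).image_notMem⟩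
  · rw [himg]
    exact (hv t t.2).image_eq

end Selection

/-! ### Matrices of circuits; small numbers of wires. -/

section Matrices

open Matrix

variable {n : ℕ}

theorem mat2_mul (a b c d a' b' c' d' : ℂ) : mat2 a b c d * mat2 a' b' c' d' =
    mat2 (a * a' + b * c') (a * b' + b * d') (c * a' + d * c') (c * b' + d * d') := by
  ext y x
  rw [Matrix.mul_apply, show (Finset.univ : Finset (ZMod 2)) = {0, 1} from rfl,
    Finset.sum_pair zero_ne_one]
  rcases zmod_two_eq_zero_or_one y with rfl | rfl <;>
    rcases zmod_two_eq_zero_or_one x with rfl | rfl <;> simp [mat2]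

theorem mat2_one : mat2 1 0 0 1 = 1 := by
  ext y x
  rcases zmod_two_eq_zero_or_one y with rfl | rfl <;>
    rcases zmod_two_eq_zero_or_one x with rfl | rfl <;> simp [mat2]

theorem mat2_conjTranspose (a b c d : ℂ) :
    (mat2 a b c d).conjTranspose = mat2 (star a) (star c) (star b) (star d) := by
  ext y x
  rcases zmod_two_eq_zero_or_one y with rfl | rfl <;>
    rcases zmod_two_eq_zero_or_one x with rfl | rfl <;> simp [mat2]

theorem gateV_zero : gateV 0 = gateX := by
  simp only [gateV, gateX, pow_zero, div_one, mul_comm Complex.I, Complex.exp_pi_mul_I]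
  norm_num

theorem gateV_succ_mul_self (i : ℕ) : gateV (i + 1) * gateV (i + 1) = gateV i := by
  have h : Complex.exp (Complex.I * Real.pi / 2 ^ i) =
      Complex.exp (Complex.I * Real.pi / 2 ^ (i + 1)) ^ 2 := by
    rw [← Complex.exp_nat_mul]
    congr 1
    rw [pow_succ]
    field_simp
    norm_num
  simp only [gateV, h, mat2_mul]
  congr 1 <;> ring

theorem gateV_mul_conjTranspose (i : ℕ) : gateV i * (gateV i).conjTranspose = 1 := by
  have h : Complex.exp (Complex.I * Real.pi / 2 ^ i) *
      star (Complex.exp (Complex.I * Real.pi / 2 ^ i)) = 1 := by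
    have e : Complex.I * Real.pi / 2 ^ i = ((Real.pi / 2 ^ i : ℝ) : ℂ) * Complex.I := by
      push_cast; ring
    rw [e, Complex.star_def, Complex.mul_conj, Complex.normSq_eq_norm_sq,
      Complex.norm_exp_ofReal_mul_I]
    norm_num
  simp only [gateV, mat2_conjTranspose, mat2_mul, ← mat2_one]
  generalize Complex.exp (Complex.I * Real.pi / 2 ^ i) = ω at h
  simp only [star_div₀, star_add, star_sub, star_one, star_ofNat]
  congr 1 <;> first | linear_combination h / 2 | linear_combination -h / 2

/-- The matrix applying `F x` to the wire `t`, depending on the other bits of the basis state. -/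
noncomputable def multiplexed (t : Fin n) (F : Bits n → Matrix (ZMod 2) (ZMod 2) ℂ) :
    Matrix (Bits n) (Bits n) ℂ :=
  Matrix.of fun y x => if ∀ j, j ≠ t → y j = x j then F x (y t) (x t) else 0

theorem agree_off_iff {t : Fin n} {x y : Bits n} :
    (∀ j, j ≠ t → y j = x j) ↔ y = Function.update x t (y t) := by
  constructor
  · intro h
    ext j
    by_cases hj : j = t
    · subst hj; simp
    · simp [hj, h j hj]
  · intro h j hj
    rw [h]; simp [hj]

/-- The right factor changes only the wire `t`; since `F` does not depend on that bit, the left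
factor still selects the matrix `F x`. -/
theorem multiplexed_mul (t : Fin n) (F G : Bits n → Matrix (ZMod 2) (ZMod 2) ℂ)
    (hF : ∀ x b, F (Function.update x t b) = F x) :
    multiplexed t F * multiplexed t G = multiplexed t fun x => F x * G x := by
  ext y x
  rw [Matrix.mul_apply]
  have hinj : Function.Injective fun b => Function.update x t b := fun b b' h => by
    simpa using congrFun h t
  rw [← Finset.sum_subset (Finset.subset_univ (Finset.univ.image fun b => Function.update x t b)),
    Finset.sum_image hinj.injOn]
  · simp only [multiplexed, Matrix.of_apply, hF, Function.update_self, Matrix.mul_apply]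
    have h1 : ∀ b, ∀ j, j ≠ t → Function.update x t b j = x j := fun b j hj => by simp [hj]
    have h2 : ∀ b, (∀ j, j ≠ t → y j = Function.update x t b j) ↔ ∀ j, j ≠ t → y j = x j :=
      fun b => forall₂_congr fun j hj => by rw [h1 b j hj]
    simp only [h2, if_pos (h1 _)]
    split_ifs <;> simp
  · intro z _ hz
    have : ¬ ∀ j, j ≠ t → z j = x j := fun h =>
      hz (Finset.mem_image.2 ⟨z t, Finset.mem_univ _, (agree_off_iff.1 h).symm⟩)
    simp [multiplexed, this]

theorem permMatrix_mul (σ τ : Equiv.Perm (Bits n)) :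
    permMatrix (σ * τ) = permMatrix σ * permMatrix τ := by
  ext y x
  simp [permMatrix, Matrix.mul_apply]
  split_ifs with h
  exacts [if_pos h, if_neg h]

theorem permMatrix_one : permMatrix (1 : Equiv.Perm (Bits n)) = 1 := by
  ext y x
  simp [permMatrix, Matrix.one_apply]
  split_ifs with h
  exacts [if_pos h, if_neg h]

theorem permMatrix_conj (σ : Equiv.Perm (Bits n)) (A : Matrix (Bits n) (Bits n) ℂ) (y x : Bits n) :
    (permMatrix σ⁻¹ * A * permMatrix σ) y x = A (σ y) (σ x) := by
  rw [Matrix.mul_apply, Finset.sum_eq_single (σ x)]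
  · rw [Matrix.mul_apply, Finset.sum_eq_single (σ y)]
    · simp [permMatrix]
    · intro z _ hz
      simp only [permMatrix, Matrix.of_apply]
      rw [if_neg, zero_mul]
      rintro rfl
      simp at hz
    · simp
  · intro z _ hz
    simp [permMatrix, hz]
  · simp

/-- The gate `G` on the wire `t`, controlled by the wires in `S`. -/
noncomputable def multiControlled (S : Finset (Fin n)) (t : Fin n)
    (G : Matrix (ZMod 2) (ZMod 2) ℂ) : Matrix (Bits n) (Bits n) ℂ :=
  multiplexed t fun x => if ∀ j ∈ S, x j = 1 then G else 1

theorem multiControlled_empty (t : Fin n) (G : Matrix (ZMod 2) (ZMod 2) ℂ) :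
    multiControlled ∅ t G = onWire t G := by
  ext y x
  simp [multiControlled, multiplexed, onWire]

theorem multiControlled_singleton (c t : Fin n) (G : Matrix (ZMod 2) (ZMod 2) ℂ) :
    multiControlled {c} t G = controlled c t G := by
  ext y x
  simp only [multiControlled, multiplexed, controlled, onWire, Matrix.of_apply,
    Finset.mem_singleton, forall_eq]
  by_cases h : x c = 1
  · simp [h]
  · simp only [h, if_false, Matrix.one_apply]
    rw [← ite_and]
    congr 1
    rw [eq_iff_iff]
    constructor
    · rintro ⟨h1, h2⟩
      ext j
      by_cases hj : j = t
      · rw [hj, h2]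
      · exact h1 j hj
    · rintro rfl
      simp

theorem multiControlled_gateX (S : Finset (Fin n)) (t : Fin n) (ht : t ∉ S) :
    multiControlled S t gateX = permMatrix (mcNot S (fun _ => 1) t ht) := by
  ext y x
  simp only [multiControlled, multiplexed, permMatrix, Matrix.of_apply]
  change _ = if y = (if ∀ j ∈ S, x j = 1 then Function.update x t (x t + 1) else x) then _ else _
  by_cases h : ∀ j ∈ S, x j = 1
  · rw [if_pos h, if_pos h]
    by_cases hyx : ∀ j, j ≠ t → y j = x j
    · rw [if_pos hyx, agree_off_iff.1 hyx]
      simp only [Function.update_self, (Function.update_injective x t).eq_iff]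
      generalize y t = u
      generalize x t = v
      rcases zmod_two_eq_zero_or_one u with rfl | rfl <;>
        rcases zmod_two_eq_zero_or_one v with rfl | rfl <;>
        simp [gateX, mat2, CharTwo.add_self_eq_zero]
    · rw [if_neg hyx, if_neg]
      rintro rfl
      exact hyx fun j hj => by simp [hj]
  · rw [if_neg h, if_neg h]
    by_cases hyx : y = x
    · subst hyx; simp
    · rw [if_neg hyx]
      split_ifs with h1
      · rw [Matrix.one_apply_ne]
        intro h2
        exact hyx (by rw [agree_off_iff.1 h1, h2]; simp)
      · rfl

/-- Barenco et al.: a controlled square as a product of gates with fewer controls. -/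
theorem multiControlled_insert (S : Finset (Fin n)) (c t : Fin n) (hc : c ∉ S) (hct : c ≠ t)
    (ht : t ∉ S) (W W' : Matrix (ZMod 2) (ZMod 2) ℂ) (hW : W * W' = 1) :
    multiControlled (insert c S) t (W * W) =
      multiControlled {c} t W * ((permMatrix (mcNot S (fun _ => 1) c hc) *
        multiControlled {c} t W' * permMatrix (mcNot S (fun _ => 1) c hc)) *
        multiControlled S t W) := by
  set σ := mcNot S (fun _ => 1) c hc with hσ
  have hσx : ∀ x, σ x = fun i => x i + if i = c then ∏ j ∈ S, x j else 0 :=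
    mcNot_one_apply S c hc
  have hW' : W' * W = 1 := mul_eq_one_comm.1 hW
  -- Conjugating by the NOT on `c` replaces the control value `x c` by its sum with the product over
  -- `S`.
  have hconj : permMatrix σ * multiControlled {c} t W' * permMatrix σ =
      multiplexed t fun x => if x c + ∏ j ∈ S, x j = 1 then W' else 1 := by
    ext y x
    have hP := permMatrix_conj σ (multiControlled {c} t W') y x
    rw [show σ⁻¹ = σ from mcNot_inv ..] at hP
    rw [hP]
    have hS : ∀ j ∈ S, j ≠ t := fun j hj => ne_of_mem_of_not_mem hj ht
    have hiff : (∀ j, j ≠ t → σ y j = σ x j) ↔ ∀ j, j ≠ t → y j = x j := by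
      have aux : ∀ u v : Bits n, (∀ j, j ≠ t → u j = v j) → ∀ j, j ≠ t → σ u j = σ v j := by
        intro u v h j hj
        rw [hσx, hσx]
        simp only [h j hj]
        rw [Finset.prod_congr rfl fun j hj => h j (hS j hj)]
      refine ⟨fun h => ?_, aux y x⟩
      have := aux _ _ h
      rwa [show σ (σ y) = y from σ.symm_apply_apply y,
        show σ (σ x) = x from σ.symm_apply_apply x] at this
    have ht' : ∀ x, σ x t = x t := fun x => by rw [hσx]; simp [hct.symm]
    have hc' : σ x c = x c + ∏ j ∈ S, x j := by rw [hσx]; simp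
    simp only [multiControlled, multiplexed, Matrix.of_apply, hiff, ht', Finset.mem_singleton,
      forall_eq, hc']
  have hupd : ∀ x : Bits n, ∀ b, ∀ j ≠ t, Function.update x t b j = x j := fun x b j hj =>
    Function.update_of_ne hj _ _
  have hS : ∀ j ∈ S, j ≠ t := fun j hj => ne_of_mem_of_not_mem hj ht
  have hprod : ∀ x : Bits n, ∀ b, ∏ j ∈ S, Function.update x t b j = ∏ j ∈ S, x j := fun x b =>
    Finset.prod_congr rfl fun j hj => hupd x b j (hS j hj)
  rw [hconj]
  simp only [multiControlled]
  rw [multiplexed_mul, multiplexed_mul]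
  · congr 1
    ext1 x
    simp only [Finset.mem_singleton, forall_eq, Finset.forall_mem_insert]
    -- With `W' = W⁻¹`, `u = x c` and `p` the product over `S`, the total exponent of `W` is `u - (u
    -- xor p) + p = 2 * u * p`.
    by_cases hSx : ∀ j ∈ S, x j = 1
    · rw [Finset.prod_eq_one hSx]
      have hSx' : (∀ j ∈ S, x j = 1) ↔ True := iff_true_intro hSx
      rcases zmod_two_eq_zero_or_one (x c) with h0 | h0
      · simp [h0, hSx', hW']
      · simp [h0, hSx', CharTwo.add_self_eq_zero]
    · obtain ⟨j, hj, hj'⟩ : ∃ j ∈ S, x j ≠ 1 := by simpa using hSx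
      rw [Finset.prod_eq_zero hj ((zmod_two_eq_zero_or_one (x j)).resolve_right hj')]
      rcases zmod_two_eq_zero_or_one (x c) with h0 | h0
      · simp [h0, hSx]
      · simp [h0, hSx, hW]
  · intro x b
    simp [hct]
  · intro x b
    rw [hupd x b c hct, hprod]

/-- `A` is the matrix of a circuit with at most `N` gates. -/
def HasCircuit (N : ℕ) (A : Matrix (Bits n) (Bits n) ℂ) : Prop :=
  ∃ c : List (Gate n), circuitMatrix c = A ∧ c.length ≤ N

theorem circuitMatrix_append (c c' : List (Gate n)) :
    circuitMatrix (c ++ c') = circuitMatrix c' * circuitMatrix c := by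
  induction c with
  | nil => simp [circuitMatrix]
  | cons g c ih => simp [circuitMatrix, ih, Matrix.mul_assoc]

theorem HasCircuit.mul {N N' : ℕ} {A B : Matrix (Bits n) (Bits n) ℂ} (hA : HasCircuit N A)
    (hB : HasCircuit N' B) : HasCircuit (N + N') (A * B) := by
  obtain ⟨c, h, hc⟩ := hA
  obtain ⟨c', h', hc'⟩ := hB
  exact ⟨c' ++ c, by rw [circuitMatrix_append, h, h'], by simp; omega⟩

theorem HasCircuit.mono {N N' : ℕ} {A : Matrix (Bits n) (Bits n) ℂ} (hA : HasCircuit N A)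
    (h : N ≤ N') : HasCircuit N' A := by
  obtain ⟨c, h', hc⟩ := hA
  exact ⟨c, h', hc.trans h⟩

theorem hasCircuit_one : HasCircuit 0 (1 : Matrix (Bits n) (Bits n) ℂ) := ⟨[], rfl, le_rfl⟩

theorem hasCircuit_gate (g : Gate n) : HasCircuit 1 g.matrix :=
  ⟨[g], by simp [circuitMatrix], by simp⟩

/-- A Toffoli gate is the case `W = V₁`, a square root of NOT: three controlled roots and two CNOT
gates. Its three distinct wires force `3 ≤ n`, which makes `V₁` available. -/
theorem hasCircuit_simple {g : Equiv.Perm (Bits n)} (hg : g ∈ simples n) :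
    HasCircuit 5 (permMatrix g) := by
  rcases hg with ⟨t, h⟩ | ⟨c, t, h⟩ | ⟨c, c', t, hcc, h⟩
  · rw [h.eq_mcNot, ← multiControlled_gateX, multiControlled_empty]
    exact (hasCircuit_gate (.not t)).mono (by norm_num)
  · have hct : c ≠ t := fun e => h.1 (by simp [e])
    rw [h.eq_mcNot, ← multiControlled_gateX, multiControlled_singleton]
    exact (hasCircuit_gate (.cnot c t hct)).mono (by norm_num)
  · have hct : c ≠ t := fun e => h.1 (by simp [e])
    have hct' : c' ≠ t := fun e => h.1 (by simp [e])
    have hn : 1 + 2 ≤ n := by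
      have := Finset.card_le_univ ({c, c', t} : Finset (Fin n))
      rwa [Finset.card_eq_three.2 ⟨c, c', t, hcc, hct, hct', rfl⟩, Fintype.card_fin] at this
    have hc : c ∉ ({c'} : Finset (Fin n)) := by simpa using hcc
    rw [h.eq_mcNot, ← multiControlled_gateX, ← gateV_zero, ← gateV_succ_mul_self,
      multiControlled_insert {c'} c t hc hct (by simpa using hct'.symm) _ _
        (gateV_mul_conjTranspose 1), ← multiControlled_gateX]
    simp only [multiControlled_singleton]
    have h1 := hasCircuit_gate (.cnot c' c hcc.symm)
    exact (hasCircuit_gate (.cv 1 le_rfl hn c t hct)).mul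
      (((h1.mul (hasCircuit_gate (.cvdag 1 le_rfl hn c t hct))).mul h1).mul
        (hasCircuit_gate (.cv 1 le_rfl hn c' t hct')))

theorem Words.hasCircuit {N : ℕ} {σ : Equiv.Perm (Bits n)} (h : Words (simples n) N σ) :
    HasCircuit (5 * N) (permMatrix σ) := by
  obtain ⟨w, hw, hlen, rfl⟩ := h
  suffices HasCircuit (5 * w.length) (permMatrix w.prod) from this.mono (by omega)
  clear hlen
  induction w with
  | nil => simpa [permMatrix_one] using hasCircuit_one
  | cons g w ih =>
    rw [List.prod_cons, permMatrix_mul]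
    refine ((hasCircuit_simple (hw g (by simp))).mul (ih fun g hg => hw g (by simp [hg]))).mono ?_
    simp; omega

/-- Recursion on the number of controls. Removing a control raises the order of the root by one, so
`S.card + i` does not grow and the final singly controlled root has index at most `n - 2`, within
the gate set. This reaches `n - 1` controls with no wire to borrow. -/
theorem exists_hasCircuit_multiControlled (k : ℕ) (S : Finset (Fin n)) (t : Fin n) (i : ℕ)
    (ht : t ∉ S) (hS : S.card = k + 1) (hi : S.card + i + 1 ≤ n) :
    ∃ N, HasCircuit N (multiControlled S t (gateV i)) := by
  induction k generalizing S t i with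
  | zero =>
    obtain ⟨c, rfl⟩ := Finset.card_eq_one.1 hS
    have hct : c ≠ t := fun e => ht (by simp [e])
    rw [multiControlled_singleton]
    rcases Nat.eq_zero_or_pos i with rfl | hi0
    · rw [gateV_zero]
      exact ⟨1, hasCircuit_gate (.cnot c t hct)⟩
    · exact ⟨1, hasCircuit_gate (.cv i hi0 (by omega) c t hct)⟩
  | succ k ih =>
    obtain ⟨c, hcS⟩ := Finset.card_pos.1 (show 0 < S.card by omega)
    have hcard := Finset.card_erase_of_mem hcS
    have hct : c ≠ t := ne_of_mem_of_not_mem hcS ht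
    have hc : c ∉ S.erase c := Finset.notMem_erase c S
    have ht' : t ∉ S.erase c := fun h => ht (Finset.mem_of_mem_erase h)
    rw [← Finset.insert_erase hcS, ← gateV_succ_mul_self,
      multiControlled_insert _ c t hc hct ht' _ _ (gateV_mul_conjTranspose _),
      ← multiControlled_gateX, ← gateV_zero]
    simp only [multiControlled_singleton]
    obtain ⟨N₁, h₁⟩ := ih (S.erase c) c 0 hc (by omega) (by omega)
    obtain ⟨N₂, h₂⟩ := ih (S.erase c) t (i + 1) ht' (by omega) (by omega)
    exact ⟨_, (hasCircuit_gate (.cv (i + 1) (by omega) (by omega) c t hct)).mul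
      (((h₁.mul (hasCircuit_gate (.cvdag (i + 1) (by omega) (by omega) c t hct))).mul h₁).mul h₂)⟩

/-- The permutations implemented by some circuit. -/
def implementable (n : ℕ) : Submonoid (Equiv.Perm (Bits n)) where
  carrier := {σ | ∃ N, HasCircuit N (permMatrix σ)}
  one_mem' := ⟨0, by rw [permMatrix_one]; exact hasCircuit_one⟩
  mul_mem' := by
    rintro σ τ ⟨N, h⟩ ⟨N', h'⟩
    exact ⟨N + N', by rw [permMatrix_mul]; exact h.mul h'⟩

theorem mcNot_univ_erase_eq_swap (x : Bits n) (t : Fin n) :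
    mcNot (Finset.univ.erase t) x t (by simp) = Equiv.swap x (Function.update x t (x t + 1)) := by
  ext1 y
  change (if ∀ j ∈ Finset.univ.erase t, y j = x j then Function.update y t (y t + 1) else y) = _
  have hiff : (∀ j ∈ Finset.univ.erase t, y j = x j) ↔ ∀ j, j ≠ t → y j = x j := by simp
  simp only [hiff]
  by_cases h : ∀ j, j ≠ t → y j = x j
  · rw [if_pos h]
    have hy := agree_off_iff.1 h
    by_cases ht : y t = x t
    · have : y = x := by rw [hy, ht]; simp
      subst this
      rw [Equiv.swap_apply_left]
    · have ht' : y t = x t + 1 := by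
        revert ht
        generalize y t = u
        generalize x t = v
        revert u v; decide
      rw [ht'] at hy
      rw [hy, Equiv.swap_apply_right]
      simp [add_assoc, CharTwo.add_self_eq_zero]
  · rw [if_neg h, Equiv.swap_apply_of_ne_of_ne]
    · rintro rfl; simp at h
    · rintro rfl; exact h fun j hj => by simp [hj]

theorem mcNot_univ_erase_mem_implementable (hn : 2 ≤ n) (x : Bits n) (t : Fin n) :
    mcNot (Finset.univ.erase t) x t (by simp) ∈ implementable n := by
  obtain ⟨ν, hν, h⟩ := exists_nots ((Finset.univ.erase t).filter fun j => x j = 0)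
  have hν' : ν ∈ implementable n := ⟨_, hν.hasCircuit⟩
  rw [mcNot_eq_conj (by simp) x ((Finset.univ.erase t).filter fun j => x j = 0) (fun j hj => by
    rcases zmod_two_eq_zero_or_one (x j) with h0 | h0 <;>
      simp [Finset.ne_of_mem_erase hj, h0, CharTwo.add_self_eq_zero]) h]
  refine mul_mem hν' (mul_mem ?_ hν')
  have hcard : (Finset.univ.erase t).card = n - 1 := by
    rw [Finset.card_erase_of_mem (Finset.mem_univ t), Finset.card_univ, Fintype.card_fin]
  obtain ⟨N, hN⟩ := exists_hasCircuit_multiControlled (n - 2) (Finset.univ.erase t) t 0 (by simp)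
    (by omega) (by omega)
  rw [gateV_zero, multiControlled_gateX _ _ (by simp)] at hN
  exact ⟨N, hN⟩

/-- NOT gates with `n - 1` controls are the transpositions along the edges of the hypercube. The
hypercube is connected, so they generate a transitive group, and a transitive group generated by
transpositions is the full symmetric group. -/
theorem implementable_eq_top (hn : 2 ≤ n) : implementable n = ⊤ := by
  let T : Set (Equiv.Perm (Bits n)) :=
    Set.range fun p : Bits n × Fin n => Equiv.swap p.1 (Function.update p.1 p.2 (p.1 p.2 + 1))
  have hT : T ⊆ implementable n := by
    rintro _ ⟨⟨x, t⟩, rfl⟩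
    simp only
    rw [← mcNot_univ_erase_eq_swap]
    exact mcNot_univ_erase_mem_implementable hn x t
  have hswap : ∀ σ ∈ T, σ.IsSwap := by
    rintro _ ⟨⟨x, t⟩, rfl⟩
    refine ⟨_, _, fun h => ?_, rfl⟩
    have := congrFun h t
    simp at this
  have hreach : ∀ F : Finset (Fin n), ∀ x : Bits n, ∃ g ∈ Subgroup.closure T,
      g x = fun i => x i + if i ∈ F then 1 else 0 := by
    intro F
    induction F using Finset.induction_on with
    | empty => exact fun x => ⟨1, one_mem _, by simp⟩
    | insert t F ht ih =>
      intro x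
      obtain ⟨g, hg, hgx⟩ := ih x
      refine ⟨Equiv.swap (g x) (Function.update (g x) t (g x t + 1)) * g,
        mul_mem (Subgroup.subset_closure ⟨(g x, t), rfl⟩) hg, ?_⟩
      rw [Equiv.Perm.mul_apply, Equiv.swap_apply_left, hgx]
      ext i
      by_cases hi : i = t
      · subst hi; simp [ht]
      · simp [hi]
  have : MulAction.IsPretransitive (Subgroup.closure T) (Bits n) := by
    refine ⟨fun x y => ?_⟩
    obtain ⟨g, hg, hgx⟩ := hreach (Finset.univ.filter fun i => x i ≠ y i) x
    refine ⟨⟨g, hg⟩, ?_⟩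
    change g x = y
    rw [hgx]
    ext i
    simp only [Finset.mem_filter, Finset.mem_univ, true_and]
    generalize x i = u
    generalize y i = v
    revert u v; decide
  have htop := closure_of_isSwap_of_isPretransitive hswap
  -- In a finite group inverses are powers, so closure under products suffices.
  have h2 : (Subgroup.closure T).toSubmonoid = Submonoid.closure T :=
    Subgroup.closure_toSubmonoid_of_finite
  rw [eq_top_iff]
  intro σ _
  have h3 : σ ∈ (Subgroup.closure T).toSubmonoid := by rw [htop]; trivial
  rw [h2] at h3
  exact (Submonoid.closure_le.2 hT) h3

theorem exists_circuit_bound (M : ℕ) : ∃ N : ℕ, ∀ n, 2 ≤ n → n ≤ M → ∀ σ : Equiv.Perm (Bits n),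
    ∃ c : List (Gate n), Implements c σ ∧ c.length ≤ N := by
  have h1 : ∀ n, ∃ N : ℕ, 2 ≤ n → ∀ σ : Equiv.Perm (Bits n), HasCircuit N (permMatrix σ) := by
    intro n
    by_cases hn : 2 ≤ n
    · have h2 : ∀ σ : Equiv.Perm (Bits n), ∃ N, HasCircuit N (permMatrix σ) := fun σ => by
        have : σ ∈ implementable n := by rw [implementable_eq_top hn]; trivial
        exact this
      choose f hf using h2
      exact ⟨Finset.univ.sup f, fun _ σ => (hf σ).mono (Finset.le_sup (Finset.mem_univ σ))⟩
    · exact ⟨0, fun h => absurd h hn⟩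
  choose f hf using h1
  exact ⟨(Finset.range (M + 1)).sup f, fun n hn hnM σ =>
    (hf n hn σ).mono (Finset.le_sup (f := f) (Finset.mem_range.2 (by omega)))⟩

end Matrices

/-! ### One round of the procedure and its iteration. -/

section Procedure

variable {n : ℕ}

theorem exists_mainSwap {m : ℕ} (hm : 2 ≤ m) (hmn : m < n) : ∃ T : Equiv.Perm (Bits n),
    IsMainSwap m T ∧ Words (simples n) (18 * n + 4) T ∧
    (∀ t, T (swapBits n m (2 * t)) = swapBits n m (2 * t + 1)) ∧
    (∀ t, T (swapBits n m (2 * t + 1)) = swapBits n m (2 * t)) ∧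
    ∀ y, T y ≠ y → ∃ j < 2 ^ m, y = swapBits n m j := by
  let ctrl : Finset (Fin n) := Finset.univ.filter fun j : Fin n => j.val < n - m
  let l : Fin n := ⟨n - 1, by omega⟩
  -- The second to last wire is not a control because `m ≥ 2`; it is the wire to borrow.
  let d : Fin n := ⟨n - 2, by omega⟩
  have hl : l ∉ ctrl := by simp [ctrl, l]; omega
  have hd : d ∉ ctrl := by simp [ctrl, d]; omega
  have hdl : d ≠ l := by simp only [d, l, ne_eq, Fin.mk.injEq]; omega
  set T := mcNot ctrl (unitBits n 0) l hl with hT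
  have hTx : ∀ x, T x = if ∀ j ∈ ctrl, x j = unitBits n 0 j then
      Function.update x l (x l + 1) else x := fun _ => rfl
  have heven : ∀ t, T (swapBits n m (2 * t)) = swapBits n m (2 * t + 1) := by
    intro t
    rw [hTx, if_pos]
    · ext q
      by_cases hq : q = l
      · subst hq
        rw [Function.update_self]
        have hlm : ¬ l.val < n - m := by simp only [l]; omega
        have hl0 : n - 1 - l.val = 0 := Nat.sub_self _
        simp only [swapBits, if_neg hlm, hl0, Nat.testBit_zero]
        simp
      · rw [Function.update_of_ne hq]
        have hq' : q.val < n - 1 := by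
          have := q.2
          have : q.val ≠ n - 1 := fun h => hq (Fin.ext h)
          omega
        obtain ⟨i, hi⟩ : ∃ i, n - 1 - q.val = i + 1 := ⟨n - 2 - q.val, by omega⟩
        simp only [swapBits, hi, Nat.testBit_succ]
        rw [show 2 * t / 2 = t by omega, show (2 * t + 1) / 2 = t by omega]
    · intro j hj
      have hj : j.val < n - m := (Finset.mem_filter.1 hj).2
      simp [swapBits, unitBits, hj]
  have hTT : ∀ x, T (T x) = x := fun x => T.symm_apply_apply x
  refine ⟨T, ⟨l, by simp only [l]; omega, isMCNot_mcNot ..⟩,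
    words_mcNot ctrl _ l d hl hd hdl, heven, fun t => by rw [← heven, hTT], fun y hy => ?_⟩
  have hpat : ∀ j ∈ ctrl, y j = unitBits n 0 j := by
    by_contra h
    exact hy (by rw [hTx, if_neg h])
  refine ⟨Nat.ofBits fun i : Fin m => decide (y ⟨n - 1 - i.val, by omega⟩ = 1),
    Nat.ofBits_lt_two_pow _, ?_⟩
  ext q
  by_cases hq : q.val < n - m
  · rw [hpat q (Finset.mem_filter.2 ⟨Finset.mem_univ _, hq⟩)]
    simp [swapBits, unitBits, hq]
  · simp only [swapBits, hq, if_false]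
    rw [Nat.testBit_ofBits_lt _ _ (by omega)]
    have : (⟨n - 1 - (n - 1 - q.val), by omega⟩ : Fin n) = q := Fin.ext (by simp only; omega)
    rw [this]
    rcases zmod_two_eq_zero_or_one (y q) with h0 | h0 <;> simp [h0]

/-- `Q` acts only on moved states of `P`, so `Q * P` moves no new state, and it fixes the `k` states
`a t`. -/
theorem card_support_mul_add_le {k : ℕ} (P Q : Equiv.Perm (Bits n)) (a : Fin k → Bits n)
    (ha : Function.Injective a) (hPa : ∀ t, P (a t) ≠ a t) (hQ : ∀ t, Q (P (a t)) = a t)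
    (hQ' : ∀ x, (∀ t, x ≠ a t ∧ x ≠ P (a t)) → Q x = x) :
    (Q * P).support.card + k ≤ P.support.card := by
  have hsub : (Q * P).support ⊆ P.support \ Finset.univ.image a := by
    intro x hx
    rw [Equiv.Perm.mem_support, Equiv.Perm.mul_apply] at hx
    rw [Finset.mem_sdiff, Equiv.Perm.mem_support]
    constructor
    · intro h
      rw [h] at hx
      refine hx (hQ' x fun t => ⟨?_, ?_⟩)
      · rintro rfl; exact hPa t h
      · intro hxt
        have : x = a t := P.injective (by rw [h, ← hxt])
        exact hPa t (by rw [← this, h])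
    · rintro hxa
      obtain ⟨t, -, rfl⟩ := Finset.mem_image.1 hxa
      exact hx (hQ t)
  have himg : Finset.univ.image a ⊆ P.support := by
    intro x hx
    obtain ⟨t, -, rfl⟩ := Finset.mem_image.1 hx
    exact Equiv.Perm.mem_support.2 (hPa t)
  have h1 := Finset.card_le_card hsub
  rw [Finset.card_sdiff_of_subset himg, Finset.card_image_of_injective _ ha, Finset.card_univ,
    Fintype.card_fin] at h1
  have h2 := Finset.card_le_card himg
  rw [Finset.card_image_of_injective _ ha, Finset.card_univ, Fintype.card_fin] at h2
  omega

/-- Serves to absorb a cost of `n log n` into `n² / log n`. -/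
theorem log_sq_le {x : ℝ} (hx : 1 ≤ x) : Real.log x * Real.log x ≤ 4 * x := by
  have h0 : 0 ≤ Real.log x := Real.log_nonneg hx
  have h1 : Real.log x = 2 * Real.log (Real.sqrt x) := by
    rw [Real.log_sqrt (by linarith)]; ring
  have h2 : Real.log (Real.sqrt x) ≤ Real.sqrt x :=
    (Real.log_le_sub_one_of_pos (by positivity)).trans (by linarith)
  have h3 : Real.log x ≤ 2 * Real.sqrt x := by linarith
  calc _ ≤ (2 * Real.sqrt x) * (2 * Real.sqrt x) := by gcongr
    _ = 4 * (Real.sqrt x * Real.sqrt x) := by ring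
    _ = 4 * x := by rw [Real.mul_self_sqrt (by linarith)]

theorem exists_step (hn : 8 ≤ n) {K : ℝ} (hK : 745 ≤ K) (P : Equiv.Perm (Bits n))
    (hP : 2 ^ (2 * 2 ^ (Nat.log 2 n - 2) - 1) < P.support.card) :
    ∃ (Q : Equiv.Perm (Bits n)) (c : List (Gate n)), IsStep K P Q ∧ Implements c Q ∧
      (c.length : ℝ) ≤ 745 * (n ^ 2 / Real.log n) ∧
      (Q * P).support.card + 2 ^ (Nat.log 2 n - 2) ≤ P.support.card := by
  set L := Nat.log 2 n with hL
  have hL3 : 3 ≤ L := Nat.le_log_of_pow_le (by norm_num) (by omega)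
  have hpow : 2 ^ L ≤ n := Nat.pow_log_le_self 2 (by omega)
  set m := L - 1 with hm
  have hLm : L = m + 1 := by omega
  set k := 2 ^ (m - 1) with hk
  have hkL : 2 ^ (L - 2) = k := by rw [hk, hm]; congr 1
  rw [hkL] at hP ⊢
  have hkm : 2 ^ m = 2 * k := by rw [hk, ← pow_succ']; congr 1; omega
  have hmn : 2 * 2 ^ m ≤ n := by rw [← pow_succ', ← hLm]; exact hpow
  have hmlt : m < 2 ^ m := Nat.lt_two_pow_self
  have hk0 : 0 < k := by positivity
  -- real estimates
  set r : ℝ := n ^ 2 / Real.log n with hr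
  have hn1 : (1 : ℝ) ≤ n := by exact_mod_cast (by omega : 1 ≤ n)
  have hlog0 : 0 < Real.log n := Real.log_pos (by exact_mod_cast (by omega : 1 < n))
  have hlog2 : (L : ℝ) * Real.log 2 ≤ Real.log n := by
    rw [← Real.log_pow]
    exact Real.log_le_log (by positivity) (by exact_mod_cast hpow)
  have hlog2' := Real.log_two_gt_d9
  have hLlog : (L : ℝ) + 1 ≤ 2 * Real.log n := by
    have h3 : (3 : ℝ) ≤ L := by exact_mod_cast hL3
    nlinarith
  have hnr : (n : ℝ) ≤ r := by
    rw [hr, le_div_iff₀ hlog0, sq]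
    gcongr
    exact (Real.log_le_sub_one_of_pos (by linarith)).trans (by linarith)
  have hnlogr : n * Real.log n ≤ 4 * r := by
    rw [hr, ← mul_div_assoc, le_div_iff₀ hlog0]
    have := log_sq_le hn1
    nlinarith
  have hr0 : 0 ≤ r := by linarith
  -- the construction
  obtain ⟨a, z, hlin, hmoved, hz0, hspan, hb⟩ := exists_pairs P (by omega) hP
  obtain ⟨R₁, R₂, w, hR₁, hR₂, hw, hwlen, hE⟩ :=
    exists_pairMap hk0 (by omega) a (fun t => P (a t)) z hlin hmoved
      (fun t => hb t)
  set E := R₂ * w.prod * R₁ with hEdef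
  obtain ⟨M, hMw, hM⟩ := exists_unaryToBinary (n := n) (m := m) (by omega)
  obtain ⟨T, hT, hTw, hTe, hTo, hTfix⟩ := exists_mainSwap (n := n) (m := m) (by omega) (by omega)
  obtain ⟨N₁, hN₁, hN₁r⟩ := words_of_isLinearRev_log hn R₁ hR₁
  obtain ⟨N₂, hN₂, hN₂r⟩ := words_of_isLinearRev_log hn R₂ hR₂
  have hww : Words (simples n) k w.prod := ⟨w, fun g hg => Or.inr (Or.inr (hw g hg)), hwlen.le, rfl⟩
  have hEw : Words (simples n) (N₂ + k + N₁) E :=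
    ((hN₂.mono_set (cnots_subset.trans toffolis_subset)).mul hww).mul
      (hN₁.mono_set (cnots_subset.trans toffolis_subset))
  have hMEw := (hMw.mono_set toffolis_subset).mul hEw
  have hMcost : ((2 ^ m * (m + 2) : ℕ) : ℝ) ≤ n * Real.log n := by
    have h1 : 2 ^ m * (m + 2) * 2 ≤ n * (L + 1) := by
      rw [hLm]; nlinarith
    have h2 : (((2 ^ m * (m + 2) : ℕ) : ℝ)) * 2 ≤ n * (L + 1) := by exact_mod_cast h1
    nlinarith
  set NE := 2 ^ m * (m + 2) + (N₂ + k + N₁) with hNE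
  have hkn : (k : ℝ) ≤ n := by exact_mod_cast (by omega : k ≤ n)
  -- Two linear maps contribute `30 * r` each, the address map `4 * r`, and the Toffoli gates
  -- between the linear maps `k ≤ n ≤ r`.
  have hNEr : (NE : ℝ) ≤ 65 * r := by
    rw [hNE]; push_cast at hMcost ⊢; linarith
  have hinvw := hMEw.inv inv_mem_simples
  have hQw := (hinvw.mul hTw).mul hMEw
  set Q := (M * E)⁻¹ * T * (M * E) with hQdef
  -- The conjugating map occurs twice and `18 * n + 4 ≤ 19 * r`; with five elementary gates per
  -- simple gate this is `5 * (65 + 19 + 65) = 745`.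
  have hQcost : ((5 * (NE + (18 * n + 4) + NE) : ℕ) : ℝ) ≤ 745 * r := by
    have : (8 : ℝ) ≤ n := by exact_mod_cast hn
    push_cast; linarith
  obtain ⟨c, hc, hclen⟩ := hQw.hasCircuit
  obtain ⟨c', hc', hclen'⟩ := hMEw.hasCircuit
  have hinv : ∀ x, (M * E)⁻¹ ((M * E) x) = x := (M * E).symm_apply_apply
  have hMEa : ∀ t, (M * E) (a t) = swapBits n m (2 * t.val) := fun t => by
    rw [Equiv.Perm.mul_apply, (hE t).1, hM _ (by omega)]
  have hMEb : ∀ t, (M * E) (P (a t)) = swapBits n m (2 * t.val + 1) := fun t => by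
    rw [Equiv.Perm.mul_apply, (hE t).2, hM _ (by omega)]
  have hQa : ∀ t, Q (a t) = P (a t) := fun t => by
    rw [hQdef, Equiv.Perm.mul_apply, Equiv.Perm.mul_apply, hMEa, hTe, ← hMEb,
      hinv]
  have hQb : ∀ t, Q (P (a t)) = a t := fun t => by
    rw [hQdef, Equiv.Perm.mul_apply, Equiv.Perm.mul_apply, hMEb, hTo, ← hMEa,
      hinv]
  have hQfix : ∀ x, (∀ t, x ≠ a t ∧ x ≠ P (a t)) → Q x = x := by
    intro x hx
    by_contra hne
    obtain ⟨j, hj, hxj⟩ := hTfix ((M * E) x) fun h => hne (by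
      rw [hQdef, Equiv.Perm.mul_apply, Equiv.Perm.mul_apply, h, hinv])
    rw [hkm] at hj
    rcases Nat.even_or_odd' j with ⟨t, rfl | rfl⟩
    · exact (hx ⟨t, by omega⟩).1 ((M * E).injective (by rw [hxj, hMEa]))
    · exact (hx ⟨t, by omega⟩).2 ((M * E).injective (by rw [hxj, hMEb]))
  have hainj : Function.Injective a := by
    intro t t' h
    have h1 := (hE t).1
    rw [h, (hE t').1] at h1
    have h2 := congrFun h1 ⟨2 * t.val, by omega⟩
    simp only [unitBits, if_true] at h2
    by_contra hne
    have : t.val ≠ t'.val := fun h => hne (Fin.ext h)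
    rw [if_neg (by omega)] at h2
    exact zero_ne_one h2
  refine ⟨Q, c, ?_, hc, ?_, card_support_mul_add_le P Q a hainj hmoved hQb hQfix⟩
  · refine ⟨a, E, M, T, hmoved, ⟨z, hlin, hz0, hspan⟩, fun t => ⟨hQa t, hQb t⟩, hQfix, hT, rfl,
      hE, ⟨R₁, R₂, w, hR₁, hR₂, hw, hwlen, rfl⟩, hM, ?_, c', hc', ?_⟩
    · obtain ⟨v, hv, hvlen, rfl⟩ := hMw
      refine ⟨v, hv, ?_, rfl⟩
      have h1 : (v.length : ℝ) ≤ (2 ^ m * (m + 2) : ℕ) := by exact_mod_cast hvlen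
      have h2 : 0 ≤ n * Real.log n := by positivity
      nlinarith
    · have h1 : (c'.length : ℝ) ≤ (5 * NE : ℕ) := by exact_mod_cast hclen'
      push_cast at h1
      nlinarith
  · exact le_trans (by exact_mod_cast hclen) hQcost

theorem implements_append {c c' : List (Gate n)} {σ τ : Equiv.Perm (Bits n)}
    (h : Implements c σ) (h' : Implements c' τ) : Implements (c ++ c') (τ * σ) := by
  rw [Implements, circuitMatrix_append, h, h', permMatrix_mul]

/-- Each round lowers the support by at least `2 ^ (Nat.log 2 n - 2)`, which gives both the
termination and the bound on the number `d` of rounds. -/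
theorem exists_procedure (hn : 8 ≤ n) {K : ℝ} (hK : 745 ≤ K) (s : ℕ) (P : Equiv.Perm (Bits n))
    (hs : P.support.card ≤ s) :
    ∃ (PQ : Equiv.Perm (Bits n)) (c : List (Gate n)) (d : ℕ), Implements c PQ ∧
      (c.length : ℝ) ≤ d * (745 * (n ^ 2 / Real.log n)) ∧
      (PQ * P).support.card ≤ 2 ^ (2 * 2 ^ (Nat.log 2 n - 2) - 1) ∧
      d * 2 ^ (Nat.log 2 n - 2) ≤ P.support.card ∧ Procedure K P c (PQ * P) d := by
  induction s using Nat.strong_induction_on generalizing P with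
  | _ s ih =>
    by_cases hP : P.support.card ≤ 2 ^ (2 * 2 ^ (Nat.log 2 n - 2) - 1)
    · exact ⟨1, [], 0, permMatrix_one.symm, by simp, by simpa using hP, by simp,
        by simpa using Procedure.done P⟩
    · obtain ⟨Q, c₁, hstep, himpl, hlen, hsupp⟩ := exists_step hn hK P (by omega)
      have hk0 : 0 < 2 ^ (Nat.log 2 n - 2) := by positivity
      obtain ⟨PQ, c, d, himpl', hlen', hsupp', hd, hproc⟩ :=
        ih (Q * P).support.card (by omega) (Q * P) le_rfl
      have hlog0 : 0 < Real.log n := Real.log_pos (by exact_mod_cast (by omega : 1 < n))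
      have hr0 : 0 ≤ (n : ℝ) ^ 2 / Real.log n := by positivity
      rw [← mul_assoc] at hsupp' hproc
      refine ⟨PQ * Q, c₁ ++ c, d + 1, implements_append himpl himpl', ?_, hsupp', ?_,
        Procedure.step hstep himpl (hlen.trans (by gcongr)) hproc⟩
      · rw [List.length_append]; push_cast; linarith
      · rw [add_mul, one_mul]; omega

end Procedure
end RevSynth

/-! ### Assembly of the bounds. -/

theorem theorem2 :
    ∃ K : ℝ, 0 < K ∧ ∀ n : ℕ, 2 ≤ n → ∀ P : Equiv.Perm (RevSynth.Bits n),
      ∃ (PQ : Equiv.Perm (RevSynth.Bits n)) (c : List (RevSynth.Gate n)),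
        RevSynth.Implements c PQ ∧
        (c.length : ℝ) ≤ K * (2 ^ n * n / Real.log n) ∧
        (((PQ * P).support.card : ℕ) : ℝ) ≤ (2 : ℝ) ^ ((n : ℝ) / 2 - 1) ∧
        (8 ≤ n → ∃ d : ℕ, (d : ℝ) ≤ 8 * 2 ^ n / n ∧
          RevSynth.Procedure K P c (PQ * P) d) := by
  obtain ⟨N, hN⟩ := RevSynth.exists_circuit_bound 7
  -- `5960 = 8 * 745` is the number of rounds times the cost of a round; `N` covers all permutations
  -- on at most `7` wires.
  refine ⟨5960 + N, by positivity, fun n hn P => ?_⟩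
  have hn1 : (1 : ℝ) ≤ n := by exact_mod_cast (by omega : 1 ≤ n)
  have hlog0 : 0 < Real.log n := Real.log_pos (by exact_mod_cast (by omega : 1 < n))
  have hlogn : Real.log n ≤ n := (Real.log_le_sub_one_of_pos (by linarith)).trans (by linarith)
  have hpow1 : (1 : ℝ) ≤ 2 ^ n := one_le_pow₀ (by norm_num)
  have hx1 : 1 ≤ 2 ^ n * n / Real.log n := by
    rw [le_div_iff₀ hlog0]; nlinarith
  by_cases h8 : 8 ≤ n
  · have hL3 : 3 ≤ Nat.log 2 n := Nat.le_log_of_pow_le (by norm_num) (by omega)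
    have hpow : 2 ^ Nat.log 2 n ≤ n := Nat.pow_log_le_self 2 (by omega)
    have hlt : n < 2 ^ (Nat.log 2 n + 1) := Nat.lt_pow_succ_log_self (by norm_num) n
    obtain ⟨PQ, c, d, himpl, hlen, hsupp, hd, hproc⟩ :=
      RevSynth.exists_procedure h8 (K := 5960 + N) (by linarith [Nat.cast_nonneg (α := ℝ) N])
        _ P le_rfl
    set k := 2 ^ (Nat.log 2 n - 2) with hk
    have h4 : 2 ^ Nat.log 2 n = 4 * k := by
      rw [hk, show 4 = 2 ^ 2 by norm_num, ← pow_add]; congr 1; omega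
    rw [pow_succ] at hlt
    have hk0 : 0 < k := by positivity
    have hcard : P.support.card ≤ 2 ^ n := by
      refine (Finset.card_le_univ _).trans ?_
      simp [ZMod.card]
    have hdn : (d : ℝ) ≤ 8 * 2 ^ n / n := by
      rw [le_div_iff₀ (by linarith)]
      -- From `d * k ≤ 2 ^ n` and `n < 8 * k`.
      have h1 : d * n ≤ 8 * 2 ^ n := by nlinarith
      exact_mod_cast h1
    refine ⟨PQ, c, himpl, ?_, ?_, fun _ => ⟨d, hdn, hproc⟩⟩
    · calc (c.length : ℝ) ≤ d * (745 * (n ^ 2 / Real.log n)) := hlen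
        _ ≤ (8 * 2 ^ n / n) * (745 * (n ^ 2 / Real.log n)) := by gcongr
        _ = 5960 * (2 ^ n * n / Real.log n) := by field_simp; norm_num
        _ ≤ _ := by gcongr; linarith [Nat.cast_nonneg (α := ℝ) N]
    · have h1 : (((PQ * P).support.card : ℕ) : ℝ) ≤ (2 : ℝ) ^ (2 * k - 1) := by exact_mod_cast hsupp
      refine h1.trans ?_
      rw [← Real.rpow_natCast]
      -- The exponents compare because `4 * k ≤ n` gives `2 * k - 1 ≤ n / 2 - 1`.
      refine Real.rpow_le_rpow_of_exponent_le (by norm_num) ?_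
      rw [Nat.cast_sub (by omega)]
      have h2 : ((4 * k : ℕ) : ℝ) ≤ n := by exact_mod_cast (h4 ▸ hpow)
      push_cast at h2 ⊢
      linarith
  -- On few wires `P⁻¹` itself is implemented, which leaves an empty support.
  · obtain ⟨c, hc, hlen⟩ := hN n hn (by omega) P⁻¹
    refine ⟨P⁻¹, c, hc, ?_, ?_, fun h => absurd h h8⟩
    · have h1 : (c.length : ℝ) ≤ N := by exact_mod_cast hlen
      nlinarith
    · rw [inv_mul_cancel, Equiv.Perm.support_one]
      simp only [Finset.card_empty, Nat.cast_zero]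
      positivity
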